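/- All functions are real functions on $\mathbb R$. For $H$ continuous and coercive ($H(p)\to+\infty$ as $|p|\to\infty$) and $V$ continuous and $1$-periodic, the effective Hamiltonian $\overline H$ of $H(p)+V(x)$ is the function whose value at $p\in\mathbb R$ is the unique constant $b$ for which the cell problem $H(p+v'(x))+V(x)=b$ has a continuous $1$-periodic viscosity solution $v$. Two continuous $1$-periodic potentials are called macroscopically indistinguishable if they have the same effective Hamiltonian for every continuous coercive $H$. Let $s\in(0,1)$ and let $V_s$ be the $1$-periodic function with $V_s(x)=-\frac{x}{s}$ on $[0,s]$ and $V_s(x)=\frac{x-1}{1-s}$ on $[s,1]$. Let $m\ge 2$, let $0=a_1<c_1<a_2<\dots<a_{m-1}<c_{m-1}<a_m=1$, and let $\hat V$ be the $1$-periodic function with $\hat V(a_i)=0$ for $1\le i\le m$ and $\hat V(c_i)=-1$ for $1\le i\le m-1$ that is affine on each of the intervals $[a_i,c_i]$ and $[c_i,a_{i+1}]$, $1\le i\le m-1$. Consider the balance condition $$\sum_{i=1}^{m-1}\frac{c_i-a_i}{s}=\sum_{i=1}^{m-1}\frac{a_{i+1}-c_i}{1-s}\tag{B}$$ (equivalently: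 the total length of the intervals $[a_i,c_i]$ where $\hat V$ decreases is $s$ and that of the intervals $[c_i,a_{i+1}]$ where it increases is $1-s$). Theorem. For $V\in\{\hat V,V_s\}$ the effective Hamiltonian of $H(p)+V(x)$ is well defined for every continuous coercive $H$: for each $p$ there is exactly one such constant $b$. Moreover: (1) If (B) holds, then $\hat V$ and $V_s$ are macroscopically indistinguishable. (2) Let $F:[0,\infty)\to\mathbb R$ be continuous with $F(r)\to+\infty$ as $r\to+\infty$, and suppose that there are $0<\theta_3<\theta_2<\theta_1$ with $F(0)=0$, $F(\theta_2)=\frac12$, $F(\theta_1)=F(\theta_3)=\frac13$ such that $F$ is strictly increasing on $[0,\theta_2]$ and on $[\theta_1,+\infty)$ and strictly decreasing on $[\theta_2,\theta_1]$. If, for $H(p)=F(|p|)$, the effective Hamiltonians of $H(p)+\hat V(x)$ and $H(p)+V_s(x)$ are equal, then (B) holds. -/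

import Mathlib

open Set Filter Topology

/-- `v` is a continuous `1`-periodic viscosity solution of the one-dimensional cell problem
`H (p + v') + V x = c` on `ℝ / ℤ`, tested with `C¹` functions touching `v` from above
(subsolution) and from below (supersolution). -/
structure IsCellSolution (H V : ℝ → ℝ) (p c : ℝ) (v : ℝ → ℝ) : Prop where
  continuous : Continuous v
  periodic : Function.Periodic v 1
  subsolution : ∀ φ : ℝ → ℝ, ContDiff ℝ 1 φ → ∀ x : ℝ,
    IsLocalMax (fun y => v y - φ y) x → H (p + deriv φ x) + V x ≤ c
  supersolution : ∀ φ : ℝ → ℝ, ContDiff ℝ 1 φ → ∀ x : ℝ,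
    IsLocalMin (fun y => v y - φ y) x → c ≤ H (p + deriv φ x) + V x

/-- The cell problem at `p` with right-hand side `c` has a solution. -/
def CellSolvable (H V : ℝ → ℝ) (p c : ℝ) : Prop :=
  ∃ v : ℝ → ℝ, IsCellSolution H V p c v

/-- The effective Hamiltonian of `H(p) + V(x)`: its value at `p` is the constant `c` for which
the cell problem at `p` has a solution. -/
noncomputable def effectiveHamiltonian (H V : ℝ → ℝ) (p : ℝ) : ℝ :=
  Classical.epsilon (fun c : ℝ => CellSolvable H V p c)

/-- A coercive function on the line: `H p → +∞` as `|p| → ∞`. -/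
def IsCoerciveHamiltonian (H : ℝ → ℝ) : Prop :=
  Tendsto H (cocompact ℝ) atTop

/-- The potentials `V₁` and `V₂` have the same effective Hamiltonian for every coercive
continuous `H`. -/
def MacroscopicallyIndistinguishable (V₁ V₂ : ℝ → ℝ) : Prop :=
  ∀ H : ℝ → ℝ, Continuous H → IsCoerciveHamiltonian H →
    effectiveHamiltonian H V₁ = effectiveHamiltonian H V₂

/-- The sawtooth potential: on `[0,1]` it goes linearly from `0` down to `-1` on `[0,s]` and
back up to `0` on `[s,1]`; extended with period `1`. -/
noncomputable def sawtooth (s x : ℝ) : ℝ :=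
  if Int.fract x ≤ s then -(Int.fract x / s) else (Int.fract x - 1) / (1 - s)

/-- `V` is the `1`-periodic piecewise linear function oscillating between `0` and `-1` with
nodes `0 = a 1 < c 1 < a 2 < ⋯ < a (m-1) < c (m-1) < a m = 1`, `m ≥ 2`. -/
structure IsOscillatingPL (m : ℕ) (a c : ℕ → ℝ) (V : ℝ → ℝ) : Prop where
  two_le : 2 ≤ m
  first : a 1 = 0
  last : a m = 1
  lt_c : ∀ i ∈ Finset.Ico 1 m, a i < c i
  c_lt : ∀ i ∈ Finset.Ico 1 m, c i < a (i + 1)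
  periodic : Function.Periodic V 1
  value_a : ∀ i ∈ Finset.Icc 1 m, V (a i) = 0
  value_c : ∀ i ∈ Finset.Ico 1 m, V (c i) = -1
  linear_left : ∀ i ∈ Finset.Ico 1 m, ∃ α β : ℝ, ∀ x ∈ Icc (a i) (c i), V x = α * x + β
  linear_right : ∀ i ∈ Finset.Ico 1 m, ∃ α β : ℝ, ∀ x ∈ Icc (c i) (a (i + 1)), V x = α * x + β

/-- The profiles `F : [0,∞) → ℝ` of the nonconvex Hamiltonian `F(|p|)` (only the values of `F`
on `[0,∞)` matter). -/
def IsNonconvexProfile (F : ℝ → ℝ) : Prop :=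
  ContinuousOn F (Ici 0) ∧ Tendsto F atTop atTop ∧
  ∃ θ₁ θ₂ θ₃ : ℝ, 0 < θ₃ ∧ θ₃ < θ₂ ∧ θ₂ < θ₁ ∧
    F 0 = 0 ∧ F θ₂ = 1 / 2 ∧ F θ₁ = 1 / 3 ∧ F θ₃ = 1 / 3 ∧
    StrictMonoOn F (Icc 0 θ₂) ∧ StrictMonoOn F (Ici θ₁) ∧ StrictAntiOn F (Icc θ₂ θ₁)

/-!
The problem reduces to sawtooth potentials. Let `L` be the total length of the intervals on which
the potential `V` decreases. Each monotone piece of `V` is an affine reparametrization of the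
corresponding piece of `sawtooth L`. Cutting the graph of `p x + v x`, for a solution `v` for
`sawtooth L`, at the nodes and rescaling its pieces homothetically gives a solution for `V` at the
same level: homotheties keep slopes, a test function at a node can be rescaled on its two sides
separately and stays `C¹` (`exists_test_of_copies`), and since the lengths match, the mean slope is
still `p` (`IsOscillatingPL.cellSolvable_of_sawtooth`). The balance condition says `L = s`.

That the effective Hamiltonian is well defined is shown for all continuous periodic potentials
(`existsUnique_cellSolvable`). Uniqueness is the comparison of levels by doubling the variables
(`level_le_of_sub_super`). For existence, Perron's method solves the discounted equation
`lam * v + H (v') + V = 0` in a class of functions that coercivity makes equi-Lipschitz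
(`exists_discounted_solution`), and `lam → 0`.

For `H p = F |p|` it remains to see that the effective Hamiltonian determines the length `s` of the
decreasing part of the sawtooth (`effectiveHamiltonian_sawtooth_ne`). At a small level `b ≥ 0` a
function whose slope takes values in `[0,∞)` has to change between the small and the large branch of
the inverse of `F`. Where the sawtooth decreases, `b - V` increases and the slope follows the
largest solution `q` of `F q = b - V`; where the sawtooth increases, it follows the smallest one.
These two differ for values of `b - V` in `(1/3, 1/2)`, so that the mean slope at level `0` strictly
increases with `s`. For `s < L` there is hence a mean slope at which `sawtooth L` has a subsolution
at level `0`, whereas `sawtooth s` has a supersolution at a positive level.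
-/

/-! ### Comparison -/

lemma Function.Periodic.exists_abs_le {v : ℝ → ℝ} (hv : Continuous v)
    (hp : Function.Periodic v 1) : ∃ B : ℝ, 0 ≤ B ∧ ∀ x, |v x| ≤ B := by
  obtain ⟨B, hB⟩ := isCompact_Icc.exists_bound_of_continuousOn
    (hv.continuousOn (s := Icc (0 : ℝ) 1))
  refine ⟨B, (norm_nonneg _).trans (hB 0 (by simp)), fun x => ?_⟩
  have h1 : v x = v (Int.fract x) := by
    have := hp.sub_int_mul_eq (x := x) ⌊x⌋
    rw [mul_one] at this
    exact this.symm
  rw [h1]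
  exact hB _ ⟨Int.fract_nonneg x, (Int.fract_lt_one x).le⟩

/-- Comparison for the cell problem, by doubling the variables: the level of a subsolution is at
least the level of a supersolution. -/
theorem level_le_of_sub_super {H V v₁ v₂ : ℝ → ℝ} {p c₁ c₂ : ℝ}
    (hV : Continuous V) (hv₁ : Continuous v₁) (hp₁ : Function.Periodic v₁ 1)
    (hv₂ : Continuous v₂) (hp₂ : Function.Periodic v₂ 1)
    (hsub : ∀ φ : ℝ → ℝ, ContDiff ℝ 1 φ → ∀ x : ℝ,
      IsLocalMax (fun y => v₁ y - φ y) x → H (p + deriv φ x) + V x ≤ c₁)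
    (hsup : ∀ φ : ℝ → ℝ, ContDiff ℝ 1 φ → ∀ x : ℝ,
      IsLocalMin (fun y => v₂ y - φ y) x → c₂ ≤ H (p + deriv φ x) + V x) :
    c₂ ≤ c₁ := by
  by_contra! hlt
  obtain ⟨δ, hδ, hδ1, hVδ⟩ : ∃ δ > 0, δ ≤ 1 ∧ ∀ x ∈ Icc (-1 : ℝ) 2, ∀ y ∈ Icc (-1 : ℝ) 2,
      |x - y| < δ → |V x - V y| < c₂ - c₁ := by
    obtain ⟨δ, hδ, h⟩ := Metric.uniformContinuousOn_iff.1
      (isCompact_Icc.uniformContinuousOn_of_continuous (hV.continuousOn (s := Icc (-1 : ℝ) 2)))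
      (c₂ - c₁) (by linarith)
    exact ⟨min δ 1, by positivity, min_le_right _ _, fun x hx y hy hxy =>
      h x hx y hy (hxy.trans_le (min_le_left _ _))⟩
  obtain ⟨B₁, hB₁0, hB₁⟩ := hp₁.exists_abs_le hv₁
  obtain ⟨B₂, hB₂0, hB₂⟩ := hp₂.exists_abs_le hv₂
  -- the penalization is so strong that maxima lie within `δ` of the diagonal
  set k : ℝ := (2 * (B₁ + B₂) + 1) / δ ^ 2 with hk
  have hk0 : 0 < k := by positivity
  have hkδ : k * δ ^ 2 = 2 * (B₁ + B₂) + 1 := by rw [hk]; field_simp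
  set Φ : ℝ × ℝ → ℝ := fun z => v₁ z.1 - v₂ z.2 - k * (z.1 - z.2) ^ 2 with hΦ
  have hΦc : Continuous Φ := by fun_prop
  have hfar : ∀ x y : ℝ, δ ≤ |x - y| → Φ (x, y) < Φ (0, 0) := by
    intro x y hxy
    have h1 : δ ^ 2 ≤ (x - y) ^ 2 := by
      rw [← sq_abs (x - y)]; gcongr
    have h2 := mul_le_mul_of_nonneg_left h1 hk0.le
    have h3 := abs_le.1 (hB₁ x)
    have h4 := abs_le.1 (hB₂ y)
    have h5 := abs_le.1 (hB₁ 0)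
    have h6 := abs_le.1 (hB₂ 0)
    simp only [hΦ, sub_self]
    linarith
  obtain ⟨⟨x, y⟩, hxyK, hmaxK⟩ := ((isCompact_Icc (a := (0 : ℝ)) (b := 1)).prod
    (isCompact_Icc (a := -δ) (b := 1 + δ))).exists_isMaxOn
    ⟨(0, 0), by simp [hδ.le]; linarith⟩ hΦc.continuousOn
  have hmax : ∀ x' y' : ℝ, Φ (x', y') ≤ Φ (x, y) := by
    intro x' y'
    have hshift : Φ (x', y') = Φ (Int.fract x', y' - ⌊x'⌋) := by
      have e1 := hp₁.sub_int_mul_eq (x := x') ⌊x'⌋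
      have e2 := hp₂.sub_int_mul_eq (x := y') ⌊x'⌋
      rw [mul_one] at e1 e2
      simp only [hΦ, Int.fract]
      rw [e1, e2]
      ring
    rw [hshift]
    have hf0 := Int.fract_nonneg x'
    have hf1 := (Int.fract_lt_one x').le
    by_cases hin : y' - ⌊x'⌋ ∈ Icc (-δ) (1 + δ)
    · exact hmaxK (Set.mk_mem_prod ⟨hf0, hf1⟩ hin)
    · refine (hfar _ _ ?_).le.trans (hmaxK (Set.mk_mem_prod (by simp) ⟨by linarith, by linarith⟩))
      by_contra! hc
      rw [abs_lt] at hc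
      exact hin ⟨by linarith, by linarith⟩
  have hnear : |x - y| < δ := by
    by_contra! hc
    exact absurd (hmax 0 0) (not_le.2 (hfar x y hc))
  have h1 := hsub (fun z => k * (z - y) ^ 2) (by fun_prop) x
    (Filter.Eventually.of_forall fun z => by
      have := hmax z y
      simp only [hΦ] at this ⊢
      linarith)
  have h2 := hsup (fun z => -(k * (x - z) ^ 2)) (by fun_prop) y
    (Filter.Eventually.of_forall fun z => by
      have := hmax x z
      simp only [hΦ] at this ⊢
      linarith)
  have d1 : deriv (fun z => k * (z - y) ^ 2) x = 2 * k * (x - y) := by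
    have : HasDerivAt (fun z => k * (z - y) ^ 2) (k * (2 * (x - y) ^ 1 * 1)) x := by
      simpa using (((hasDerivAt_id x).sub_const y).pow 2).const_mul k
    rw [this.deriv]; ring
  have d2 : deriv (fun z => -(k * (x - z) ^ 2)) y = 2 * k * (x - y) := by
    have : HasDerivAt (fun z => -(k * (x - z) ^ 2)) (-(k * (2 * (x - y) ^ 1 * (-1)))) y := by
      simpa using! ((((hasDerivAt_id y).const_sub x).pow 2).const_mul k).neg
    rw [this.deriv]; ring
  rw [d1] at h1
  rw [d2] at h2
  obtain ⟨hx, hy⟩ := Set.mem_prod.1 hxyK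
  have h3 := hVδ x ⟨by linarith [hx.1], by linarith [hx.2]⟩ y
    ⟨by linarith [hy.1], by linarith [hy.2]⟩ hnear
  rw [abs_lt] at h3
  linarith

/-! ### Stability -/

/-- If `v - φ` has a local maximum at `x₀`, then every `w` close to `v` near `x₀` is touched from
above near `x₀` by a test function whose slope there is close to `φ' x₀`. Closeness is only needed
from above on a neighbourhood and from below at `x₀`, which makes the lemma apply to uniform limits
as well as to pointwise suprema. -/
lemma exists_nearby_touching {v φ : ℝ → ℝ} {x₀ : ℝ} (hφ : ContDiff ℝ 1 φ)
    (hmax : IsLocalMax (fun y => v y - φ y) x₀) {η : ℝ} (hη : 0 < η) :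
    ∃ ε > 0, ∀ w : ℝ → ℝ, Continuous w → (∀ x, |x - x₀| ≤ 1 → w x ≤ v x + ε) →
      v x₀ - ε ≤ w x₀ → ∃ ψ : ℝ → ℝ, ContDiff ℝ 1 ψ ∧ ∃ x, |x - x₀| < η ∧
        |deriv ψ x - deriv φ x₀| < η ∧ IsLocalMax (fun y => w y - ψ y) x := by
  have hd : Continuous (fun x => deriv φ x + 2 * (x - x₀)) := by
    have := hφ.continuous_deriv le_rfl
    fun_prop
  obtain ⟨δ, hδ, hdδ⟩ := Metric.continuous_iff.1 hd x₀ η hη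
  obtain ⟨ρ, hρ, hmaxρ⟩ := Metric.eventually_nhds_iff.1 hmax
  obtain ⟨r, hr, hr1⟩ : ∃ r > 0, r ≤ 1 ∧ r < ρ ∧ r < δ ∧ r < η := by
    refine ⟨min (min 1 (ρ / 2)) (min (δ / 2) (η / 2)), by positivity, ?_, ?_, ?_, ?_⟩
    · exact (min_le_left _ _).trans (min_le_left _ _)
    · exact ((min_le_left _ _).trans (min_le_right _ _)).trans_lt (by linarith)
    · exact ((min_le_right _ _).trans (min_le_left _ _)).trans_lt (by linarith)
    · exact ((min_le_right _ _).trans (min_le_right _ _)).trans_lt (by linarith)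
  obtain ⟨hr1, hrρ, hrδ, hrη⟩ := hr1
  refine ⟨r ^ 2 / 4, by positivity, fun w hw hle hge => ?_⟩
  set ψ : ℝ → ℝ := fun y => φ y + (y - x₀) ^ 2 with hψ
  have hψc : ContDiff ℝ 1 ψ := by fun_prop
  have hcont : Continuous (fun y => w y - ψ y) := hw.sub hψc.continuous
  obtain ⟨x, hx, hxmax⟩ := (isCompact_Icc (a := x₀ - r) (b := x₀ + r)).exists_isMaxOn
    ⟨x₀, by simp [hr.le]⟩ hcont.continuousOn
  have hxr : |x - x₀| ≤ r := by rw [abs_le]; constructor <;> linarith [hx.1, hx.2]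
  have h1 : w x₀ - ψ x₀ ≤ w x - ψ x := hxmax (⟨by linarith, by linarith⟩ : x₀ ∈ Icc _ _)
  have h2 : v x - φ x ≤ v x₀ - φ x₀ := hmaxρ (by rw [Real.dist_eq]; linarith)
  have h3 := hle x (hxr.trans hr1)
  have h4 : (x - x₀) ^ 2 ≤ r ^ 2 / 2 := by
    simp only [hψ, sub_self] at h1
    linarith
  have h5 : |x - x₀| < r := abs_lt_of_sq_lt_sq (by nlinarith) hr.le
  refine ⟨ψ, hψc, x, by linarith, ?_, ?_⟩
  · have h6 : HasDerivAt ψ (deriv φ x + 2 * (x - x₀)) x := by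
      have := ((hφ.differentiable one_ne_zero) x).hasDerivAt.add
        (((hasDerivAt_id x).sub_const x₀).pow 2)
      simpa using! this
    rw [h6.deriv]
    have := hdδ x (by rw [Real.dist_eq]; linarith)
    simpa [Real.dist_eq] using this
  · rw [abs_lt] at h5
    filter_upwards [Ioo_mem_nhds (show x₀ - r < x by linarith) (show x < x₀ + r by linarith)]
      with z hz
    exact hxmax ⟨hz.1.le, hz.2.le⟩

/-- A bounded continuous function all of whose test slopes from above are at most `K` in absolute
value is `K`-Lipschitz. -/
lemma abs_sub_le_of_test_slopes {w : ℝ → ℝ} {B K : ℝ} (hK0 : 0 ≤ K) (hw : Continuous w)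
    (hB : ∀ x, |w x| ≤ B)
    (hK : ∀ φ : ℝ → ℝ, ContDiff ℝ 1 φ → ∀ x, IsLocalMax (fun y => w y - φ y) x →
      |deriv φ x| ≤ K) (x y : ℝ) : |w x - w y| ≤ K * |x - y| := by
  have key : ∀ K' : ℝ, K < K' → 0 < K' → ∀ x y : ℝ, w y - w x ≤ K' * |y - x| := by
    intro K' hK' hK'0 x y
    by_contra! hlt
    set f : ℝ → ℝ := fun z => w z - w x - K' * |z - x| with hf
    have hfc : Continuous f := by fun_prop
    set R : ℝ := 2 * B / K' + 1 with hR
    have hB0 : 0 ≤ B := (abs_nonneg _).trans (hB 0)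
    have hR0 : 0 < R := by positivity
    have hfar : ∀ z, R ≤ |z - x| → f z < 0 := by
      intro z hz
      have h1 := mul_le_mul_of_nonneg_left hz hK'0.le
      have h2 : K' * R = 2 * B + K' := by rw [hR]; field_simp
      have h3 := abs_le.1 (hB z)
      have h4 := abs_le.1 (hB x)
      simp only [hf]
      linarith
    obtain ⟨z, -, hzK⟩ := (isCompact_Icc (a := x - R) (b := x + R)).exists_isMaxOn
      ⟨x, by simp [hR0.le]⟩ hfc.continuousOn
    have hyK : y ∈ Icc (x - R) (x + R) := by
      by_contra hy
      have : R ≤ |y - x| := by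
        by_contra! hc
        rw [abs_lt] at hc
        exact hy ⟨by linarith, by linarith⟩
      have := hfar y this
      simp only [hf] at this
      linarith
    have hzpos : 0 < f z := lt_of_lt_of_le (by simp only [hf]; linarith) (hzK hyK)
    have hzmax : ∀ t, f t ≤ f z := by
      intro t
      by_cases ht : t ∈ Icc (x - R) (x + R)
      · exact hzK ht
      · refine ((hfar t ?_).trans hzpos).le
        by_contra! hc
        rw [abs_lt] at hc
        exact ht ⟨by linarith, by linarith⟩
    have hzx : z ≠ x := by
      rintro rfl
      simp [hf] at hzpos
    -- near `z ≠ x` the cone `K' * |· - x|` is an affine function of slope `± K'`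
    have hslope : ∀ σ : ℝ, (∀ᶠ t in 𝓝 z, |t - x| = σ * (t - x)) → |σ * K'| ≤ K := by
      intro σ hσ
      have hd : ∀ t, HasDerivAt (fun t : ℝ => σ * K' * (t - x)) (σ * K') t := fun t => by
        simpa using ((hasDerivAt_id t).sub_const x).const_mul (σ * K')
      have := hK (fun t => σ * K' * (t - x)) (by fun_prop) z (by
        filter_upwards [hσ] with t ht
        have h1 := hzmax t
        have h2 := hσ.self_of_nhds
        simp only [hf, ht, h2] at h1
        linarith)
      rwa [(hd z).deriv] at this
    rcases lt_or_gt_of_ne hzx with h | h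
    · have := hslope (-1) (by
        filter_upwards [gt_mem_nhds h] with t ht
        rw [abs_of_neg (by linarith)]; ring)
      rw [neg_one_mul, abs_neg, abs_of_pos hK'0] at this
      linarith
    · have := hslope 1 (by
        filter_upwards [lt_mem_nhds h] with t ht
        rw [abs_of_pos (by linarith)]; ring)
      rw [one_mul, abs_of_pos hK'0] at this
      linarith
  have key' : ∀ x y : ℝ, w y - w x ≤ K * |y - x| := by
    intro x y
    refine le_of_forall_pos_le_add fun ε hε => ?_
    have h0 := abs_nonneg (y - x)
    refine (key (K + ε / (|y - x| + 1)) (lt_add_of_pos_right _ (by positivity))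
      (by positivity) x y).trans ?_
    rw [add_mul]
    gcongr
    rw [div_mul_eq_mul_div, div_le_iff₀ (by positivity)]
    nlinarith
  rw [abs_le]
  have h1 := key' x y
  have h2 := key' y x
  rw [abs_sub_comm] at h1
  constructor <;> linarith

/-! ### The discounted problem -/

/-- `w` is a viscosity subsolution of `lam * w + H (w') + V x = 0` on the line. -/
def IsDiscountedSub (H V : ℝ → ℝ) (lam : ℝ) (w : ℝ → ℝ) : Prop :=
  ∀ φ : ℝ → ℝ, ContDiff ℝ 1 φ → ∀ x : ℝ,
    IsLocalMax (fun y => w y - φ y) x → lam * w x + H (deriv φ x) + V x ≤ 0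

/-- `w` is a viscosity supersolution of `lam * w + H (w') + V x = 0` on the line. -/
def IsDiscountedSuper (H V : ℝ → ℝ) (lam : ℝ) (w : ℝ → ℝ) : Prop :=
  ∀ φ : ℝ → ℝ, ContDiff ℝ 1 φ → ∀ x : ℝ,
    IsLocalMin (fun y => w y - φ y) x → 0 ≤ lam * w x + H (deriv φ x) + V x

lemma IsDiscountedSub.comp_add {H V w : ℝ → ℝ} {lam t : ℝ} (hw : IsDiscountedSub H V lam w)
    (hV : ∀ x, V (x + t) = V x) : IsDiscountedSub H V lam (fun x => w (x + t)) := by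
  intro φ hφ x hx
  have h1 : IsLocalMax (fun y => w y - φ (y - t)) (x + t) := by
    have h2 : IsLocalMax (fun y => w (y + t) - φ y) (x + t - t) := by simpa using hx
    have := h2.comp_continuous (g := fun y => y - t) (b := x + t) (by fun_prop)
    simpa [Function.comp_def] using this
  have h2 := hw (fun y => φ (y - t)) (by fun_prop) (x + t) h1
  rw [deriv_comp_sub_const, hV] at h2
  simpa using h2

/-- The subsolutions among which Perron's method takes the supremum. -/
def perronClass (H V : ℝ → ℝ) (lam M : ℝ) : Set (ℝ → ℝ) :=
  {w | Continuous w ∧ (∀ x, |lam * w x| ≤ M) ∧ IsDiscountedSub H V lam w}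

lemma abs_sub_le_of_mem_perronClass {H V w : ℝ → ℝ} {lam M K : ℝ} (hlam : 0 < lam) (hK0 : 0 ≤ K)
    (hK : ∀ q x, H q + V x ≤ M → |q| ≤ K) (hw : w ∈ perronClass H V lam M) (x y : ℝ) :
    |w x - w y| ≤ K * |x - y| := by
  obtain ⟨hc, hb, hs⟩ := hw
  refine abs_sub_le_of_test_slopes (B := M / lam) hK0 hc (fun x => ?_) (fun φ hφ x hx => ?_) x y
  · have := hb x
    rw [abs_mul, abs_of_pos hlam] at this
    rw [le_div_iff₀ hlam]
    linarith
  · refine hK _ x ?_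
    have h1 := hs φ hφ x hx
    have h2 := abs_le.1 (hb x)
    linarith

/-- The bump construction of Perron's method: where a subsolution `v` fails to be a supersolution,
it can be raised locally to a strictly larger subsolution. -/
lemma exists_larger_of_not_super {H V v φ : ℝ → ℝ} {lam M x₀ : ℝ} (hlam : 0 < lam)
    (hH : Continuous H) (hV : Continuous V)
    (hM : ∀ x, |H 0 + V x| ≤ M) (hv : v ∈ perronClass H V lam M) (hφ : ContDiff ℝ 1 φ)
    (hmin : IsLocalMin (fun y => v y - φ y) x₀)
    (hneg : lam * v x₀ + H (deriv φ x₀) + V x₀ < 0) :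
    ∃ w ∈ perronClass H V lam M, v x₀ < w x₀ := by
  obtain ⟨hvc, hvb, hvs⟩ := hv
  have hlt : lam * v x₀ < M := by
    refine lt_of_le_of_ne (abs_le.1 (hvb x₀)).2 fun heq => ?_
    have hφmax : IsLocalMax φ x₀ := by
      filter_upwards [hmin] with y hy
      have h1 : lam * v y ≤ lam * v x₀ := heq ▸ (abs_le.1 (hvb y)).2
      have h2 : v y ≤ v x₀ := le_of_mul_le_mul_left h1 hlam
      linarith
    rw [hφmax.deriv_eq_zero, heq] at hneg
    have := (abs_le.1 (hM x₀)).1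
    linarith
  set ψ : ℝ → ℝ := fun y => φ y - (y - x₀) ^ 2 + (v x₀ - φ x₀) with hψ
  have hψc : ContDiff ℝ 1 ψ := by fun_prop
  have hψ0 : ψ x₀ = v x₀ := by simp [hψ]
  have hψd : deriv ψ x₀ = deriv φ x₀ := by
    have : HasDerivAt ψ (deriv φ x₀) x₀ :=
      ((((hφ.differentiable one_ne_zero) x₀).hasDerivAt.sub
        (((hasDerivAt_id x₀).sub_const x₀).pow 2)).add_const (v x₀ - φ x₀)).congr_deriv (by simp)
    exact this.deriv
  have hψ' : Continuous (deriv ψ) := hψc.continuous_deriv le_rfl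
  have hψ'' := hψc.continuous
  -- the strict inequalities at `x₀` persist for small distances and small vertical shifts
  have hev : ∀ᶠ z : ℝ × ℝ in 𝓝 (x₀, 0),
      lam * (ψ z.1 + z.2) + H (deriv ψ z.1) + V z.1 < 0 ∧ lam * (ψ z.1 + z.2) < M := by
    have c1 : Continuous fun z : ℝ × ℝ => lam * (ψ z.1 + z.2) + H (deriv ψ z.1) + V z.1 := by
      fun_prop
    have c2 : Continuous fun z : ℝ × ℝ => lam * (ψ z.1 + z.2) := by fun_prop
    exact (c1.continuousAt.eventually_lt_const (by simpa [hψ0, hψd] using hneg)).and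
      (c2.continuousAt.eventually_lt_const (by simpa [hψ0] using hlt))
  obtain ⟨e, he, hev⟩ := Metric.eventually_nhds_iff.1 hev
  obtain ⟨ρ, hρ, hminρ⟩ := Metric.eventually_nhds_iff.1 hmin
  obtain ⟨r, hr, hre, hrρ⟩ : ∃ r > 0, r < e ∧ r < ρ :=
    ⟨min e ρ / 2, by positivity, by linarith [min_le_left e ρ, lt_min he hρ],
      by linarith [min_le_right e ρ, lt_min he hρ]⟩
  obtain ⟨δ, hδ, hδe, hδr⟩ : ∃ δ > 0, δ < e ∧ δ ≤ r ^ 2 :=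
    ⟨min (e / 2) (r ^ 2), by positivity, (min_le_left _ _).trans_lt (by linarith),
      min_le_right _ _⟩
  have hin : ∀ x, |x - x₀| ≤ r →
      lam * (ψ x + δ) + H (deriv ψ x) + V x < 0 ∧ lam * (ψ x + δ) < M := by
    intro x hx
    refine hev (y := (x, δ)) ?_
    rw [Prod.dist_eq, Real.dist_eq, Real.dist_eq, sub_zero, abs_of_pos hδ]
    exact max_lt (hx.trans_lt hre) hδe
  have hψv : ∀ x, |x - x₀| ≤ r → ψ x + (x - x₀) ^ 2 ≤ v x := by
    intro x hx
    have : v x₀ - φ x₀ ≤ v x - φ x := hminρ (by rw [Real.dist_eq]; linarith)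
    simp only [hψ]
    linarith
  set w : ℝ → ℝ := fun x => if |x - x₀| ≤ r then max (v x) (ψ x + δ) else v x with hw
  have hwc : Continuous w := by
    refine Continuous.if_le (by fun_prop) hvc (by fun_prop) continuous_const fun x hx => ?_
    have := hψv x hx.le
    rw [← sq_abs, hx] at this
    exact max_eq_left (by linarith)
  have hvw : ∀ x, v x ≤ w x := by
    intro x
    simp only [hw]
    split_ifs
    · exact le_max_left _ _
    · exact le_rfl
  have hψw : ∀ x, |x - x₀| ≤ r → ψ x + δ ≤ w x := by
    intro x hx
    simp only [hw, if_pos hx]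
    exact le_max_right _ _
  have hcases : ∀ x, w x = v x ∨ (|x - x₀| < r ∧ w x = ψ x + δ) := by
    intro x
    by_cases hx : |x - x₀| ≤ r
    · simp only [hw, if_pos hx]
      rcases le_or_gt (ψ x + δ) (v x) with h | h
      · exact Or.inl (max_eq_left h)
      · refine Or.inr ⟨lt_of_le_of_ne hx fun heq => ?_, max_eq_right h.le⟩
        have := hψv x hx
        rw [← sq_abs, heq] at this
        linarith
    · exact Or.inl (by simp only [hw, if_neg hx])
  refine ⟨w, ⟨hwc, fun x => abs_le.2 ⟨?_, ?_⟩, fun χ hχ x hx => ?_⟩, ?_⟩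
  · exact (abs_le.1 (hvb x)).1.trans (mul_le_mul_of_nonneg_left (hvw x) hlam.le)
  · rcases hcases x with h | ⟨hxr, h⟩
    · rw [h]; exact (abs_le.1 (hvb x)).2
    · rw [h]; exact (hin x hxr.le).2.le
  · rcases hcases x with h | ⟨hxr, h⟩
    · rw [h]
      refine hvs χ hχ x ?_
      filter_upwards [hx] with y hy
      have := hvw y
      linarith
    · have hloc : IsLocalMax (fun y => ψ y - χ y) x := by
        have : ∀ᶠ y in 𝓝 x, |y - x₀| < r :=
          (show Continuous fun y => |y - x₀| by fun_prop).continuousAt.eventually_lt_const hxr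
        filter_upwards [hx, this] with y hy hyr
        have := hψw y hyr.le
        linarith
      have hd := hloc.deriv_eq_zero
      rw [deriv_fun_sub (hψc.differentiable one_ne_zero x) (hχ.differentiable one_ne_zero x)] at hd
      rw [h, ← sub_eq_zero.1 hd]
      exact (hin x hxr.le).1.le
  · have := hψw x₀ (by simpa using hr.le)
    linarith

/-- Perron's method for the discounted problem. -/
theorem exists_discounted_solution {H V : ℝ → ℝ} {lam M K : ℝ} (hlam : 0 < lam)
    (hH : Continuous H) (hV : Continuous V) (hVp : Function.Periodic V 1)
    (hM : ∀ x, |H 0 + V x| ≤ M) (hK0 : 0 ≤ K) (hK : ∀ q x, H q + V x ≤ M → |q| ≤ K) :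
    ∃ v : ℝ → ℝ, Function.Periodic v 1 ∧ (∀ x, |lam * v x| ≤ M) ∧
      (∀ x y, |v x - v y| ≤ K * |x - y|) ∧
      IsDiscountedSub H V lam v ∧ IsDiscountedSuper H V lam v := by
  set S := perronClass H V lam M with hS
  have hM0 : 0 ≤ M := (abs_nonneg _).trans (hM 0)
  have hLip : ∀ w ∈ S, ∀ x y, |w x - w y| ≤ K * |x - y| := fun w hw =>
    abs_sub_le_of_mem_perronClass hlam hK0 hK hw
  have hconst : (fun _ => -M / lam) ∈ S := by
    refine ⟨continuous_const, fun x => ?_, fun φ hφ x hx => ?_⟩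
    · rw [mul_div_cancel₀ _ hlam.ne', abs_neg, abs_of_nonneg hM0]
    · have : IsLocalMin φ x := by
        filter_upwards [hx] with y hy
        linarith
      rw [this.deriv_eq_zero, mul_div_cancel₀ _ hlam.ne']
      linarith [(abs_le.1 (hM x)).2]
  have hbdd : ∀ w ∈ S, ∀ x, w x ≤ M / lam := by
    intro w hw x
    rw [le_div_iff₀ hlam]
    linarith [(abs_le.1 (hw.2.1 x)).2]
  have hex : ∀ x, ∃ b, IsLUB ((fun w : ℝ → ℝ => w x) '' S) b := fun x =>
    Real.exists_isLUB ⟨_, mem_image_of_mem _ hconst⟩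
      ⟨M / lam, by rintro _ ⟨w, hw, rfl⟩; exact hbdd w hw x⟩
  choose v hv using hex
  have hle : ∀ w ∈ S, ∀ x, w x ≤ v x := fun w hw x => (hv x).1 (mem_image_of_mem _ hw)
  have hsup : ∀ x b, (∀ w ∈ S, w x ≤ b) → v x ≤ b := fun x b h =>
    (hv x).2 (by rintro _ ⟨w, hw, rfl⟩; exact h w hw)
  have hvLip' : ∀ x y, v x ≤ v y + K * |x - y| := fun x y => hsup x _ fun w hw => by
    have h1 := (abs_le.1 (hLip w hw x y)).2
    have h2 := hle w hw y
    linarith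
  have hvLip : ∀ x y, |v x - v y| ≤ K * |x - y| := fun x y => by
    have h1 := hvLip' x y
    have h2 := hvLip' y x
    rw [abs_sub_comm] at h2
    rw [abs_le]
    constructor <;> linarith
  have hvc : Continuous v :=
    (LipschitzWith.of_dist_le_mul (K := K.toNNReal) fun x y => by
      rw [Real.dist_eq, Real.dist_eq, Real.coe_toNNReal _ hK0]; exact hvLip x y).continuous
  have hvb : ∀ x, |lam * v x| ≤ M := fun x => by
    have h1 : v x ≤ M / lam := hsup x _ fun w hw => hbdd w hw x
    have h2 := hle _ hconst x
    rw [le_div_iff₀ hlam] at h1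
    rw [div_le_iff₀ hlam] at h2
    rw [abs_le]
    constructor <;> linarith
  have hper : Function.Periodic v 1 := by
    intro x
    have hneg : ∀ y, V (y + -1) = V y := fun y => by
      have := hVp (y + -1)
      rw [← this]; congr 1; ring
    refine le_antisymm (hsup _ _ fun w hw => ?_) (hsup _ _ fun w hw => ?_)
    · exact hle (fun y => w (y + 1)) ⟨hw.1.comp (by fun_prop), fun y => hw.2.1 _,
        hw.2.2.comp_add hVp⟩ x
    · have := hle (fun y => w (y + -1)) ⟨hw.1.comp (by fun_prop), fun y => hw.2.1 _,
        hw.2.2.comp_add hneg⟩ (x + 1)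
      simpa using this
  have hsub : IsDiscountedSub H V lam v := by
    intro φ hφ x₀ hx₀
    by_contra! hpos
    have hev : ∀ᶠ z : ℝ × ℝ × ℝ in 𝓝 (x₀, deriv φ x₀, 0),
        0 < lam * (v x₀ - z.2.2 - K * |z.1 - x₀|) + H z.2.1 + V z.1 :=
      (show Continuous fun z : ℝ × ℝ × ℝ =>
        lam * (v x₀ - z.2.2 - K * |z.1 - x₀|) + H z.2.1 + V z.1 by
          fun_prop).continuousAt.eventually_const_lt (by simpa using hpos)
    obtain ⟨η, hη, hev⟩ := Metric.eventually_nhds_iff.1 hev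
    obtain ⟨ε, hε, htouch⟩ := exists_nearby_touching hφ hx₀ hη
    obtain ⟨_, ⟨w, hw, rfl⟩, hwlt⟩ := (lt_isLUB_iff (hv x₀)).1
      (show v x₀ - min ε (η / 2) < v x₀ by linarith [lt_min hε (half_pos hη)])
    obtain ⟨ψ, hψ, x, hxη, hdη, hloc⟩ := htouch w hw.1
      (fun x _ => (hle w hw x).trans (by linarith))
      (by linarith [min_le_left ε (η / 2)])
    have h1 := hw.2.2 ψ hψ x hloc
    have h2 := hev (y := (x, deriv ψ x, min ε (η / 2))) (by
      rw [Prod.dist_eq, Prod.dist_eq, Real.dist_eq, Real.dist_eq, Real.dist_eq, sub_zero,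
        abs_of_pos (lt_min hε (half_pos hη))]
      exact max_lt hxη (max_lt hdη ((min_le_right _ _).trans_lt (by linarith))))
    have h3 := (abs_le.1 (hLip w hw x x₀)).1
    have h4 : lam * (v x₀ - min ε (η / 2) - K * |x - x₀|) ≤ lam * w x :=
      mul_le_mul_of_nonneg_left (by linarith) hlam.le
    linarith
  refine ⟨v, hper, hvb, hvLip, hsub, fun φ hφ x₀ hx₀ => ?_⟩
  by_contra! hneg
  obtain ⟨w, hw, hlt⟩ := exists_larger_of_not_super hlam hH hV hM ⟨hvc, hvb, hsub⟩ hφ hx₀ hneg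
  exact absurd (hle w hw x₀) (not_le.2 hlt)

/-! ### Existence for the cell problem -/

lemma exists_slope_bound {H V : ℝ → ℝ} (hHc : IsCoerciveHamiltonian H) {C : ℝ}
    (hC : ∀ x, |V x| ≤ C) (M : ℝ) : ∃ K : ℝ, 0 ≤ K ∧ ∀ q x, H q + V x ≤ M → |q| ≤ K := by
  have h1 : ∀ᶠ q in cocompact ℝ, M + C < H q := hHc.eventually_gt_atTop _
  rw [← Metric.cobounded_eq_cocompact, ← comap_norm_atTop, eventually_comap] at h1
  obtain ⟨K, hK⟩ := eventually_atTop.1 h1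
  refine ⟨max K 0, le_max_right _ _, fun q x hq => ?_⟩
  by_contra! hlt
  have h2 := hK |q| ((le_max_left _ _).trans hlt.le) q rfl
  linarith [(abs_le.1 (hC x)).1]

/-- Pointwise convergence of equi-Lipschitz functions is uniform on bounded intervals. -/
lemma eventually_forall_abs_sub_le {ι : Type*} {l : Filter ι} {u : ι → ℝ → ℝ} {u₀ : ℝ → ℝ} {K : ℝ}
    (hK0 : 0 ≤ K) (hu : ∀ i x y, |u i x - u i y| ≤ K * |x - y|)
    (hu₀ : ∀ x y, |u₀ x - u₀ y| ≤ K * |x - y|) (hlim : ∀ x, Tendsto (fun i => u i x) l (𝓝 (u₀ x)))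
    (x₀ : ℝ) {ε : ℝ} (hε : 0 < ε) : ∀ᶠ i in l, ∀ x, |x - x₀| ≤ 1 → |u i x - u₀ x| ≤ ε := by
  set ρ := ε / (3 * (K + 1)) with hρ
  have hρ0 : 0 < ρ := by positivity
  have hKρ : K * ρ ≤ ε / 3 := by
    rw [hρ, mul_div_assoc', div_le_iff₀ (by positivity)]
    nlinarith
  obtain ⟨t, -, htf, ht⟩ := (isCompact_Icc (a := x₀ - 1) (b := x₀ + 1)).finite_cover_balls hρ0
  have h1 : ∀ᶠ i in l, ∀ y ∈ t, |u i y - u₀ y| ≤ ε / 3 := by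
    rw [eventually_all_finite htf]
    intro y _
    filter_upwards [Metric.tendsto_nhds.1 (hlim y) (ε / 3) (by positivity)] with i hi
    rw [Real.dist_eq] at hi
    exact hi.le
  filter_upwards [h1] with i hi x hx
  rw [abs_le] at hx
  obtain ⟨y, hy, hxy⟩ := mem_iUnion₂.1 (ht (⟨by linarith, by linarith⟩ : x ∈ Icc _ _))
  rw [Metric.mem_ball, Real.dist_eq] at hxy
  have h2 : K * |x - y| ≤ ε / 3 := (mul_le_mul_of_nonneg_left hxy.le hK0).trans hKρ
  have h3 := abs_le.1 (hu i x y)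
  have h4 := abs_le.1 (hu₀ x y)
  have h5 := abs_le.1 (hi y hy)
  rw [abs_le]
  constructor <;> linarith

/-- Vanishing discount: the cell problem at slope `0` is solvable for some level. -/
theorem exists_cellSolvable_zero {H V : ℝ → ℝ} (hH : Continuous H)
    (hHc : IsCoerciveHamiltonian H) (hV : Continuous V) (hVp : Function.Periodic V 1) :
    ∃ b, CellSolvable H V 0 b := by
  obtain ⟨C, hC0, hC⟩ := hVp.exists_abs_le hV
  set M := |H 0| + C with hM
  have hM0 : 0 ≤ M := by positivity
  have hHM : ∀ x, |H 0 + V x| ≤ M := fun x => (abs_add_le _ _).trans (by linarith [hC x])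
  obtain ⟨K, hK0, hK⟩ := exists_slope_bound hHc hC M
  have hlam : ∀ n : ℕ, (0 : ℝ) < 1 / ((n : ℝ) + 1) := fun n => by positivity
  choose v hvp hvb hvL hvs hvS using fun n : ℕ =>
    exists_discounted_solution (hlam n) hH hV hVp hHM hK0 hK
  set lam : ℕ → ℝ := fun n => 1 / ((n : ℝ) + 1) with hlamdef
  set U : Ultrafilter ℕ := hyperfilter ℕ with hU
  have hlam0 : Tendsto lam U (𝓝 0) :=
    (tendsto_one_div_add_atTop_nhds_zero_nat (𝕜 := ℝ)).mono_left Nat.hyperfilter_le_atTop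
  -- along an ultrafilter every bounded sequence converges
  have hlimit : ∀ (f : ℕ → ℝ) (B : ℝ), (∀ n, |f n| ≤ B) → ∃ b, Tendsto f U (𝓝 b) := by
    intro f B hf
    obtain ⟨b, -, hb⟩ := (isCompact_Icc (a := -B) (b := B)).ultrafilter_le_nhds (U.map f) (by
      rw [le_principal_iff, Ultrafilter.mem_coe, Ultrafilter.mem_map]
      exact Filter.univ_mem' fun n => abs_le.1 (hf n))
    exact ⟨b, hb⟩
  obtain ⟨d, hd⟩ := hlimit (fun n => lam n * v n 0) M fun n => hvb n 0
  set u : ℕ → ℝ → ℝ := fun n x => v n x - v n 0 with hu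
  have huL : ∀ n x y, |u n x - u n y| ≤ K * |x - y| := fun n x y => by
    simpa [hu] using hvL n x y
  have hub : ∀ n x, |u n x| ≤ K * |x| := fun n x => by simpa [hu] using hvL n x 0
  choose u₀ hu₀ using fun x => hlimit (fun n => u n x) (K * |x|) fun n => hub n x
  have hu₀L : ∀ x y, |u₀ x - u₀ y| ≤ K * |x - y| := fun x y =>
    le_of_tendsto (((hu₀ x).sub (hu₀ y)).abs) (Filter.Eventually.of_forall fun n => huL n x y)
  have hu₀c : Continuous u₀ :=
    (LipschitzWith.of_dist_le_mul (K := K.toNNReal) fun x y => by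
      rw [Real.dist_eq, Real.dist_eq, Real.coe_toNNReal _ hK0]; exact hu₀L x y).continuous
  have huc : ∀ n, Continuous (u n) := fun n =>
    (LipschitzWith.of_dist_le_mul (K := K.toNNReal) fun x y => by
      rw [Real.dist_eq, Real.dist_eq, Real.coe_toNNReal _ hK0]; exact huL n x y).continuous
  have hu₀p : Function.Periodic u₀ 1 := fun x =>
    tendsto_nhds_unique (hu₀ (x + 1)) (by simpa [hu, hvp _ x] using hu₀ x)
  have hunif := fun (x₀ : ℝ) {ε : ℝ} (hε : 0 < ε) =>
    eventually_forall_abs_sub_le (l := (U : Filter ℕ)) hK0 huL hu₀L hu₀ x₀ hε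
  -- the discount terms converge to the constant `d`
  have hdisc : ∀ n x, |lam n * v n x - lam n * v n 0| ≤ lam n * (K * |x|) := fun n x => by
    rw [← mul_sub, abs_mul, abs_of_pos (hlam n)]
    exact mul_le_mul_of_nonneg_left (hub n x) (hlam n).le
  have hdiscev : ∀ x₀ η : ℝ, 0 < η → ∀ᶠ n in (U : Filter ℕ), ∀ x, |x - x₀| < 1 →
      |lam n * v n x - d| < η := by
    intro x₀ η hη
    have h1 : Tendsto (fun n => lam n * (K * (|x₀| + 1)) + |lam n * v n 0 - d|) U (𝓝 0) := by
      have := (hlam0.mul_const (K * (|x₀| + 1))).add ((hd.sub_const d).abs)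
      simpa using this
    filter_upwards [h1.eventually_lt_const hη] with n hn x hx
    have h2 : |x| ≤ |x₀| + 1 := by
      have := abs_sub_abs_le_abs_sub x x₀
      linarith
    have h3 : lam n * (K * |x|) ≤ lam n * (K * (|x₀| + 1)) := by
      have := (hlam n).le
      gcongr
    have h4 := abs_sub_le (lam n * v n x) (lam n * v n 0) d
    have h5 := hdisc n x
    linarith
  have hnear : ∀ (x₀ q₀ : ℝ) (P : Set ℝ), IsOpen P → d + H q₀ + V x₀ ∈ P →
      ∃ η > 0, η ≤ 1 ∧ ∀ x q t, |x - x₀| < η → |q - q₀| < η → |t - d| < η → t + H q + V x ∈ P := by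
    intro x₀ q₀ P hP hmem
    have hcont : Continuous fun z : ℝ × ℝ × ℝ => z.2.2 + H z.2.1 + V z.1 := by fun_prop
    obtain ⟨η, hη, h⟩ := Metric.eventually_nhds_iff.1
      (hcont.continuousAt.eventually_mem (x := (x₀, q₀, d)) (hP.mem_nhds hmem))
    refine ⟨min η 1, by positivity, min_le_right _ _, fun x q t hx hq ht => ?_⟩
    refine h (y := (x, q, t)) ?_
    rw [Prod.dist_eq, Prod.dist_eq, Real.dist_eq, Real.dist_eq, Real.dist_eq]
    have := min_le_left η 1
    exact max_lt (by linarith) (max_lt (by linarith) (by linarith))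
  refine ⟨-d, u₀, hu₀c, hu₀p, fun φ hφ x₀ hx₀ => ?_, fun φ hφ x₀ hx₀ => ?_⟩
  · rw [zero_add]
    by_contra! hpos
    obtain ⟨η, hη, hη1, hP⟩ := hnear x₀ (deriv φ x₀) (Ioi 0) isOpen_Ioi
      (by rw [mem_Ioi]; linarith)
    obtain ⟨ε, hε, htouch⟩ := exists_nearby_touching hφ hx₀ hη
    obtain ⟨n, hn1, hn2⟩ := ((hunif x₀ hε).and (hdiscev x₀ η hη)).exists
    obtain ⟨ψ, hψ, x, hxη, hdη, hloc⟩ := htouch (u n) (huc n)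
      (fun x hx => by linarith [(abs_le.1 (hn1 x hx)).2])
      (by linarith [(abs_le.1 (hn1 x₀ (by simp))).1])
    have h1 := hvs n ψ hψ x (by
      filter_upwards [hloc] with y hy
      simp only [hu] at hy
      linarith)
    have h2 := hP x (deriv ψ x) (lam n * v n x) hxη hdη (hn2 x (by linarith))
    rw [mem_Ioi] at h2
    linarith
  · rw [zero_add]
    by_contra! hneg
    obtain ⟨η, hη, hη1, hP⟩ := hnear x₀ (deriv φ x₀) (Iio 0) isOpen_Iio
      (by rw [mem_Iio]; linarith)
    -- the supersolution property is the touching lemma for the negated functions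
    obtain ⟨ε, hε, htouch⟩ := exists_nearby_touching (v := fun y => -u₀ y) (φ := fun y => -φ y)
      hφ.neg (by
        filter_upwards [hx₀] with y hy
        linarith) hη
    obtain ⟨n, hn1, hn2⟩ := ((hunif x₀ hε).and (hdiscev x₀ η hη)).exists
    obtain ⟨ψ, hψ, x, hxη, hdη, hloc⟩ := htouch (fun y => -u n y) (huc n).neg
      (fun x hx => by linarith [(abs_le.1 (hn1 x hx)).1])
      (by linarith [(abs_le.1 (hn1 x₀ (by simp))).2])
    have h1 := hvS n (fun y => -ψ y) hψ.neg x (by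
      filter_upwards [hloc] with y hy
      simp only [hu] at hy
      linarith)
    have h2 := hP x (deriv (fun y => -ψ y) x) (lam n * v n x) hxη (by
      rw [deriv.fun_neg] at hdη ⊢
      rw [abs_sub_comm]
      convert hdη using 2
      ring) (hn2 x (by linarith))
    rw [mem_Iio] at h2
    linarith

lemma isCoerciveHamiltonian_comp_const_add {H : ℝ → ℝ} (hHc : IsCoerciveHamiltonian H) (p : ℝ) :
    IsCoerciveHamiltonian (fun q => H (p + q)) :=
  hHc.comp (Homeomorph.addLeft p).isClosedEmbedding.tendsto_cocompact

/-- The effective Hamiltonian of a continuous coercive Hamiltonian with a continuous periodic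
potential is well defined. -/
theorem existsUnique_cellSolvable {H V : ℝ → ℝ} (hH : Continuous H)
    (hHc : IsCoerciveHamiltonian H) (hV : Continuous V) (hVp : Function.Periodic V 1) (p : ℝ) :
    ∃! b, CellSolvable H V p b := by
  obtain ⟨b, v, hv⟩ := exists_cellSolvable_zero (H := fun q => H (p + q)) (by fun_prop)
    (isCoerciveHamiltonian_comp_const_add hHc p) hV hVp
  refine ⟨b, ⟨v, hv.continuous, hv.periodic, ?_, ?_⟩, ?_⟩
  · simpa using hv.subsolution
  · simpa using hv.supersolution
  · rintro b' ⟨v', hv'⟩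
    have hsub : ∀ φ : ℝ → ℝ, ContDiff ℝ 1 φ → ∀ x : ℝ,
      IsLocalMax (fun y => v y - φ y) x → H (p + deriv φ x) + V x ≤ b := by
      simpa using hv.subsolution
    have hsup : ∀ φ : ℝ → ℝ, ContDiff ℝ 1 φ → ∀ x : ℝ,
      IsLocalMin (fun y => v y - φ y) x → b ≤ H (p + deriv φ x) + V x := by
      simpa using hv.supersolution
    exact le_antisymm
      (level_le_of_sub_super hV hv.continuous hv.periodic hv'.continuous hv'.periodic
        hsub hv'.supersolution)
      (level_le_of_sub_super hV hv'.continuous hv'.periodic hv.continuous hv.periodic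
        hv'.subsolution hsup)

lemma effectiveHamiltonian_eq_of_cellSolvable {H V : ℝ → ℝ} (hH : Continuous H)
    (hHc : IsCoerciveHamiltonian H) (hV : Continuous V) (hVp : Function.Periodic V 1) {p b : ℝ}
    (hb : CellSolvable H V p b) : effectiveHamiltonian H V p = b :=
  (existsUnique_cellSolvable hH hHc hV hVp p).unique
    (Classical.epsilon_spec (p := fun c => CellSolvable H V p c) ⟨b, hb⟩) hb

/-! ### Rescaling test functions -/

/-- To the right of `x`, the graph of `U` is a homothetic copy of the graph of `u` to the right
of `y`. Homotheties preserve slopes. -/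
def IsRightCopy (U u : ℝ → ℝ) (x y : ℝ) : Prop :=
  ∃ r > 0, ∀ᶠ k in 𝓝[≥] (0 : ℝ), U (x + r * k) - U x = r * (u (y + k) - u y)

/-- To the left of `x`, the graph of `U` is a homothetic copy of the graph of `u` to the left
of `y`. -/
def IsLeftCopy (U u : ℝ → ℝ) (x y : ℝ) : Prop :=
  ∃ r > 0, ∀ᶠ k in 𝓝[≤] (0 : ℝ), U (x + r * k) - U x = r * (u (y + k) - u y)

lemma IsRightCopy.neg {U u : ℝ → ℝ} {x y : ℝ} (h : IsRightCopy U u x y) :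
    IsRightCopy (fun z => -U z) (fun z => -u z) x y := by
  obtain ⟨r, hr, h⟩ := h
  refine ⟨r, hr, ?_⟩
  filter_upwards [h] with k hk
  linarith

lemma IsLeftCopy.neg {U u : ℝ → ℝ} {x y : ℝ} (h : IsLeftCopy U u x y) :
    IsLeftCopy (fun z => -U z) (fun z => -u z) x y := by
  obtain ⟨r, hr, h⟩ := h
  refine ⟨r, hr, ?_⟩
  filter_upwards [h] with k hk
  linarith

/-- A test function touching `U` from above at `x` yields one with the same slope touching `u` from
above at `y`, even if the two sides are copied with different ratios: the rescaled halves of the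
test function have equal one-sided slopes, so that they fit together to a `C¹` function. -/
lemma exists_test_of_copies {U u φ : ℝ → ℝ} {x y : ℝ} (hR : IsRightCopy U u x y)
    (hL : IsLeftCopy U u x y) (hφ : ContDiff ℝ 1 φ) (hmax : IsLocalMax (fun z => U z - φ z) x) :
    ∃ ψ : ℝ → ℝ, ContDiff ℝ 1 ψ ∧ deriv ψ y = deriv φ x ∧ IsLocalMax (fun z => u z - ψ z) y := by
  obtain ⟨r, hr, hR⟩ := hR
  obtain ⟨l, hl, hL⟩ := hL
  have hφ' : Continuous (deriv φ) := hφ.continuous_deriv le_rfl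
  set σ : ℝ → ℝ := fun t => x + r * max (t - y) 0 + l * min (t - y) 0 with hσ
  have hc : Continuous fun t => deriv φ (σ t) := by fun_prop
  set ψ : ℝ → ℝ := fun z => ∫ t in y..z, deriv φ (σ t) with hψ
  have hd : ∀ z, HasDerivAt ψ (deriv φ (σ z)) z := fun z =>
    intervalIntegral.integral_hasDerivAt_right (hc.intervalIntegrable _ _)
      hc.aestronglyMeasurable.stronglyMeasurableAtFilter hc.continuousAt
  have hdψ : deriv ψ = fun z => deriv φ (σ z) := funext fun z => (hd z).deriv
  have hcopy : ∀ q : ℝ, 0 < q → ∀ z, (∀ t ∈ uIcc y z, σ t = x + q * (t - y)) →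
      q * ψ z = φ (x + q * (z - y)) - φ x := by
    intro q hq z hz
    have h1 : ψ z = ∫ t in y..z, deriv φ (x + q * (t - y)) := by
      refine intervalIntegral.integral_congr fun t ht => ?_
      simp only [hz t ht]
    have h2 : ∀ t ∈ uIcc y z, HasDerivAt (fun t => φ (x + q * (t - y)) / q)
        (deriv φ (x + q * (t - y))) t := by
      intro t _
      have h3 : HasDerivAt (fun t => x + q * (t - y)) q t := by
        simpa using ((((hasDerivAt_id t).sub_const y).const_mul q).const_add x)
      refine ((((hφ.differentiable one_ne_zero) _).hasDerivAt.comp t h3).div_const q).congr_deriv ?_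
      field_simp
    rw [h1, intervalIntegral.integral_eq_sub_of_hasDerivAt h2
      (Continuous.intervalIntegrable (by fun_prop) _ _)]
    simp only [sub_self, mul_zero, add_zero]
    field_simp
  have hψy : ψ y = 0 := by simp [hψ]
  refine ⟨ψ, contDiff_one_iff_deriv.2 ⟨fun z => (hd z).differentiableAt, by rwa [hdψ]⟩, ?_, ?_⟩
  · rw [hdψ]; simp [hσ]
  have hside : ∀ q : ℝ, 0 < q → ∀ᶠ k in 𝓝 (0 : ℝ), U (x + q * k) - U x ≤ φ (x + q * k) - φ x := by
    intro q _
    have ht : Tendsto (fun k : ℝ => x + q * k) (𝓝 0) (𝓝 x) := by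
      have : Continuous fun k : ℝ => x + q * k := by fun_prop
      simpa using this.tendsto 0
    filter_upwards [ht.eventually hmax] with k hk
    linarith
  have hev : ∀ᶠ k in 𝓝 (0 : ℝ), u (y + k) - ψ (y + k) ≤ u y - ψ y := by
    have hun : 𝓝 (0 : ℝ) = 𝓝[≤] 0 ⊔ 𝓝[≥] 0 := (nhdsLE_sup_nhdsGE 0).symm
    rw [hun, eventually_sup]
    constructor
    · filter_upwards [hL, nhdsWithin_le_nhds (hside l hl), self_mem_nhdsWithin] with k h1 h2 h3
      have h4 := hcopy l hl (y + k) (fun t ht => by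
        rw [uIcc_of_ge (by linarith [mem_Iic.1 h3])] at ht
        simp only [hσ]
        rw [max_eq_right (by linarith [ht.2]), min_eq_left (by linarith [ht.2])]
        ring)
      rw [add_sub_cancel_left] at h4
      have h5 : l * (u (y + k) - u y) ≤ l * ψ (y + k) := by linarith
      have := le_of_mul_le_mul_left h5 hl
      linarith
    · filter_upwards [hR, nhdsWithin_le_nhds (hside r hr), self_mem_nhdsWithin] with k h1 h2 h3
      have h4 := hcopy r hr (y + k) (fun t ht => by
        rw [uIcc_of_le (by linarith [mem_Ici.1 h3])] at ht
        simp only [hσ]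
        rw [max_eq_left (by linarith [ht.1]), min_eq_right (by linarith [ht.1])]
        ring)
      rw [add_sub_cancel_left] at h4
      have h5 : r * (u (y + k) - u y) ≤ r * ψ (y + k) := by linarith
      have := le_of_mul_le_mul_left h5 hr
      linarith
  have ht : Tendsto (fun z : ℝ => z - y) (𝓝 y) (𝓝 0) := by
    have : Continuous fun z : ℝ => z - y := by fun_prop
    simpa using this.tendsto y
  filter_upwards [ht.eventually hev] with z hz
  simpa using hz

/-- A function that locally consists of homothetic copies of a solution, at points where the
potentials agree, is a solution. The copies concern the functions `p x + v x`, whose slopes enter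
the equation. -/
theorem IsCellSolution.of_copies {H V₁ V₂ v₁ v₂ : ℝ → ℝ} {p b : ℝ}
    (hv : IsCellSolution H V₁ p b v₁) (hc : Continuous v₂) (hp : Function.Periodic v₂ 1)
    (hcopy : ∀ x, ∃ y, IsRightCopy (fun z => p * z + v₂ z) (fun z => p * z + v₁ z) x y ∧
      IsLeftCopy (fun z => p * z + v₂ z) (fun z => p * z + v₁ z) x y ∧ V₂ x = V₁ y) :
    IsCellSolution H V₂ p b v₂ := by
  have hlin : ∀ x : ℝ, HasDerivAt (fun z => p * z) p x := fun x => by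
    simpa using (hasDerivAt_id x).const_mul p
  refine ⟨hc, hp, fun φ hφ x hx => ?_, fun φ hφ x hx => ?_⟩
  · obtain ⟨y, hR, hL, hV⟩ := hcopy x
    obtain ⟨ψ, hψ, hψd, hloc⟩ := exists_test_of_copies (φ := fun z => p * z + φ z) hR hL
      (by fun_prop) (by
        filter_upwards [hx] with z hz
        linarith)
    have h1 := hv.subsolution (fun z => ψ z - p * z) (by fun_prop) y (by
      filter_upwards [hloc] with z hz
      linarith)
    have h2 : deriv (fun z => ψ z - p * z) y = deriv φ x := by
      rw [((hψ.differentiable one_ne_zero y).hasDerivAt.fun_sub (hlin y)).deriv, hψd,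
        ((hlin x).fun_add (hφ.differentiable one_ne_zero x).hasDerivAt).deriv]
      ring
    rwa [h2, ← hV] at h1
  · obtain ⟨y, hR, hL, hV⟩ := hcopy x
    obtain ⟨ψ, hψ, hψd, hloc⟩ := exists_test_of_copies (φ := fun z => -(p * z + φ z))
      hR.neg hL.neg (by fun_prop) (by
        filter_upwards [hx] with z hz
        linarith)
    have h1 := hv.supersolution (fun z => -ψ z - p * z) (by fun_prop) y (by
      filter_upwards [hloc] with z hz
      linarith)
    have h2 : deriv (fun z => -ψ z - p * z) y = deriv φ x := by
      rw [((hψ.differentiable one_ne_zero y).hasDerivAt.fun_neg.fun_sub (hlin y)).deriv, hψd,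
        ((hlin x).fun_add (hφ.differentiable one_ne_zero x).hasDerivAt).fun_neg.deriv]
      ring
    rwa [h2, ← hV] at h1

/-- A function that is a homothetic copy of `u` on an interval copies `u` to the right of every
point but the last, and to the left of every point but the first. -/
lemma copies_of_interval {U u : ℝ → ℝ} {z₀ z₁ w₀ r : ℝ} (hr : 0 < r)
    (h : ∀ x ∈ Icc z₀ z₁, ∀ y ∈ Icc z₀ z₁,
      U x - U y = r * (u (w₀ + (x - z₀) / r) - u (w₀ + (y - z₀) / r))) :
    (∀ x ∈ Ico z₀ z₁, IsRightCopy U u x (w₀ + (x - z₀) / r)) ∧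
      (∀ x ∈ Ioc z₀ z₁, IsLeftCopy U u x (w₀ + (x - z₀) / r)) := by
  have heq : ∀ x k : ℝ, w₀ + (x + r * k - z₀) / r = w₀ + (x - z₀) / r + k := fun x k => by
    field_simp; ring
  have ht : ∀ x : ℝ, Tendsto (fun k : ℝ => x + r * k) (𝓝 0) (𝓝 x) := fun x => by
    have : Continuous fun k : ℝ => x + r * k := by fun_prop
    simpa using this.tendsto 0
  constructor
  · intro x hx
    refine ⟨r, hr, ?_⟩
    filter_upwards [nhdsWithin_le_nhds ((ht x).eventually_lt_const hx.2), self_mem_nhdsWithin]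
      with k hk hk0
    have : 0 ≤ r * k := mul_nonneg hr.le hk0
    rw [h _ ⟨by linarith [hx.1], hk.le⟩ _ ⟨hx.1, hx.2.le⟩, heq]
  · intro x hx
    refine ⟨r, hr, ?_⟩
    filter_upwards [nhdsWithin_le_nhds ((ht x).eventually_const_lt hx.1), self_mem_nhdsWithin]
      with k hk hk0
    have : r * k ≤ 0 := mul_nonpos_of_nonneg_of_nonpos hr.le hk0
    rw [h _ ⟨hk.le, by linarith [hx.2]⟩ _ ⟨hx.1.le, hx.2⟩, heq]

/-! ### The sawtooth and the oscillating potential -/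

lemma sawtooth_periodic (s : ℝ) : Function.Periodic (sawtooth s) 1 := fun x => by
  simp [sawtooth]

lemma sawtooth_of_le {s y : ℝ} (hs1 : s < 1) (hy : y ∈ Icc 0 s) : sawtooth s y = -(y / s) := by
  have : Int.fract y = y := Int.fract_eq_self.2 ⟨hy.1, hy.2.trans_lt hs1⟩
  rw [sawtooth, this, if_pos hy.2]

lemma sawtooth_of_ge {s y : ℝ} (hs0 : 0 < s) (hs1 : s < 1) (hy : y ∈ Icc s 1) :
    sawtooth s y = (y - 1) / (1 - s) := by
  rcases hy.2.eq_or_lt with rfl | hlt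
  · simp [sawtooth, hs0.le]
  rcases hy.1.eq_or_lt with rfl | hgt
  · rw [sawtooth_of_le hs1 ⟨hs0.le, le_rfl⟩, div_self hs0.ne', ← neg_sub 1 s, neg_div,
      div_self (by linarith)]
  · have : Int.fract y = y := Int.fract_eq_self.2 ⟨hs0.le.trans hgt.le, hlt⟩
    rw [sawtooth, this, if_neg (not_le.2 hgt)]

lemma continuous_of_periodic_of_continuousOn {f : ℝ → ℝ} (hp : Function.Periodic f 1)
    (hc : ContinuousOn f (Icc 0 1)) : Continuous f := by
  have h1 : f = f ∘ Int.fract := by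
    funext x
    have := hp.sub_int_mul_eq (x := x) ⌊x⌋
    rw [mul_one] at this
    exact this.symm
  rw [h1]
  exact hc.comp_fract'' (by have := hp 0; rw [zero_add] at this; exact this.symm)

lemma continuous_sawtooth {s : ℝ} (hs0 : 0 < s) (hs1 : s < 1) : Continuous (sawtooth s) := by
  refine continuous_of_periodic_of_continuousOn (sawtooth_periodic s) ?_
  rw [← Icc_union_Icc_eq_Icc hs0.le hs1.le]
  refine ContinuousOn.union_of_isClosed ?_ ?_ isClosed_Icc isClosed_Icc
  · exact ContinuousOn.congr (f := fun y => -(y / s)) (by fun_prop) fun y hy =>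
      sawtooth_of_le hs1 hy
  · exact ContinuousOn.congr (f := fun y => (y - 1) / (1 - s)) (by fun_prop) fun y hy =>
      sawtooth_of_ge hs0 hs1 hy

namespace IsOscillatingPL

variable {m : ℕ} {a c : ℕ → ℝ} {V : ℝ → ℝ}

lemma node_le (hV : IsOscillatingPL m a c V) {i j : ℕ} (hi : 1 ≤ i) (hij : i ≤ j) (hj : j ≤ m) :
    a i ≤ a j := by
  induction j, hij using Nat.le_induction with
  | base => exact le_rfl
  | succ k hk ih =>
    have hk' : k ∈ Finset.Ico 1 m := Finset.mem_Ico.2 ⟨hi.trans hk, by omega⟩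
    exact (ih (by omega)).trans ((hV.lt_c k hk').trans (hV.c_lt k hk')).le

lemma exists_piece (hV : IsOscillatingPL m a c V) {x : ℝ} (hx : x ∈ Ico (0 : ℝ) 1) :
    ∃ i ∈ Finset.Ico 1 m, a i ≤ x ∧ x < a (i + 1) := by
  have key : ∀ k, 1 ≤ k → x < a k → ∃ i ∈ Finset.Ico 1 k, a i ≤ x ∧ x < a (i + 1) := by
    intro k hk
    induction k, hk using Nat.le_induction with
    | base => intro h; rw [hV.first] at h; exact absurd hx.1 (not_le.2 h)
    | succ k hk ih =>
      intro h
      rcases lt_or_ge x (a k) with h1 | h1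
      · obtain ⟨i, hi, h2⟩ := ih h1
        exact ⟨i, Finset.Ico_subset_Ico_right (by omega) hi, h2⟩
      · exact ⟨k, Finset.mem_Ico.2 ⟨hk, by omega⟩, h1, h⟩
  exact key m (by linarith [hV.two_le]) (by rw [hV.last]; exact hx.2)

lemma eq_on_left (hV : IsOscillatingPL m a c V) {i : ℕ} (hi : i ∈ Finset.Ico 1 m) {x : ℝ}
    (hx : x ∈ Icc (a i) (c i)) : V x = -((x - a i) / (c i - a i)) := by
  obtain ⟨α, β, h⟩ := hV.linear_left i hi
  have hlt := hV.lt_c i hi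
  have h1 := h (a i) ⟨le_rfl, hlt.le⟩
  have h2 := h (c i) ⟨hlt.le, le_rfl⟩
  rw [hV.value_c i hi] at h2
  rw [hV.value_a i (Finset.Ico_subset_Icc_self hi)] at h1
  have h3 : c i - a i ≠ 0 := by linarith
  have h4 : α * (c i - a i) = -1 := by linarith
  rw [h x hx, ← neg_div, eq_div_iff h3]
  linear_combination (x - a i) * h4 - (c i - a i) * h1

lemma eq_on_right (hV : IsOscillatingPL m a c V) {i : ℕ} (hi : i ∈ Finset.Ico 1 m) {x : ℝ}
    (hx : x ∈ Icc (c i) (a (i + 1))) : V x = (x - a (i + 1)) / (a (i + 1) - c i) := by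
  obtain ⟨α, β, h⟩ := hV.linear_right i hi
  have hlt := hV.c_lt i hi
  have h1 := h (a (i + 1)) ⟨hlt.le, le_rfl⟩
  have h2 := h (c i) ⟨le_rfl, hlt.le⟩
  rw [hV.value_c i hi] at h2
  rw [hV.value_a (i + 1) (by rw [Finset.mem_Ico] at hi; rw [Finset.mem_Icc]; omega)] at h1
  have h3 : a (i + 1) - c i ≠ 0 := by linarith
  have h4 : α * (a (i + 1) - c i) = 1 := by linarith
  rw [h x hx, eq_div_iff h3]
  linear_combination (x - a (i + 1)) * h4 - (a (i + 1) - c i) * h1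

lemma continuous (hV : IsOscillatingPL m a c V) : Continuous V := by
  refine continuous_of_periodic_of_continuousOn hV.periodic ?_
  have key : ∀ k, 1 ≤ k → k ≤ m → ContinuousOn V (Icc (a 1) (a k)) := by
    intro k hk
    induction k, hk using Nat.le_induction with
    | base => intro _; simp
    | succ k hk ih =>
      intro hkm
      have hk' : k ∈ Finset.Ico 1 m := Finset.mem_Ico.2 ⟨hk, by omega⟩
      have h1 := (hV.lt_c k hk').le
      have h2 := (hV.c_lt k hk').le
      rw [← Icc_union_Icc_eq_Icc (hV.node_le le_rfl hk (by omega)) (h1.trans h2),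
        ← Icc_union_Icc_eq_Icc h1 h2]
      refine (ih (by omega)).union_of_isClosed (ContinuousOn.union_of_isClosed ?_ ?_
        isClosed_Icc isClosed_Icc) isClosed_Icc (isClosed_Icc.union isClosed_Icc)
      · exact ContinuousOn.congr (f := fun x => -((x - a k) / (c k - a k))) (by fun_prop)
          fun x hx => hV.eq_on_left hk' hx
      · exact ContinuousOn.congr (f := fun x => (x - a (k + 1)) / (a (k + 1) - c k)) (by fun_prop)
          fun x hx => hV.eq_on_right hk' hx
  have := key m (by linarith [hV.two_le]) le_rfl
  rwa [hV.first, hV.last] at this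

lemma sum_lengths (hV : IsOscillatingPL m a c V) :
    ∑ i ∈ Finset.Ico 1 m, (a (i + 1) - c i) = 1 - ∑ i ∈ Finset.Ico 1 m, (c i - a i) := by
  rw [eq_sub_iff_add_eq, ← Finset.sum_add_distrib]
  have h1 : ∑ i ∈ Finset.Ico 1 m, (a (i + 1) - c i + (c i - a i)) =
      ∑ i ∈ Finset.Ico 1 m, (a (i + 1) - a i) := Finset.sum_congr rfl fun i _ => by ring
  rw [h1, Finset.sum_Ico_sub a (by linarith [hV.two_le]), hV.first, hV.last, sub_zero]

lemma length_pos (hV : IsOscillatingPL m a c V) : 0 < ∑ i ∈ Finset.Ico 1 m, (c i - a i) :=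
  Finset.sum_pos (fun i hi => sub_pos.2 (hV.lt_c i hi)) (Finset.nonempty_Ico.2 hV.two_le)

lemma length_lt_one (hV : IsOscillatingPL m a c V) : ∑ i ∈ Finset.Ico 1 m, (c i - a i) < 1 := by
  have h1 : 0 < ∑ i ∈ Finset.Ico 1 m, (a (i + 1) - c i) :=
    Finset.sum_pos (fun i hi => sub_pos.2 (hV.c_lt i hi)) (Finset.nonempty_Ico.2 hV.two_le)
  rw [hV.sum_lengths] at h1
  linarith

/-- The balance condition says that the total length of the decreasing pieces is `s`. -/
lemma balance_iff (hV : IsOscillatingPL m a c V) {s : ℝ} (hs0 : 0 < s) (hs1 : s < 1) :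
    ∑ i ∈ Finset.Ico 1 m, (c i - a i) / s = ∑ i ∈ Finset.Ico 1 m, (a (i + 1) - c i) / (1 - s) ↔
      ∑ i ∈ Finset.Ico 1 m, (c i - a i) = s := by
  rw [← Finset.sum_div, ← Finset.sum_div, hV.sum_lengths,
    div_eq_div_iff hs0.ne' (by linarith : (1 - s) ≠ 0)]
  constructor <;> intro h <;> linarith

end IsOscillatingPL

/-! ### Rescaling solutions -/

namespace IsOscillatingPL

variable {m : ℕ} {a c : ℕ → ℝ} {V : ℝ → ℝ}

/-- The function on `[0,1]` that starts at `0`, and whose graph over `[a i, c i]` and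
`[c i, a (i + 1)]` is, up to translation, the homothetic copy of the graph of `u` over `[0, L]` and
`[L, 1]` respectively. Each summand is constant outside the interval it belongs to. -/
noncomputable def rescale (m : ℕ) (a c : ℕ → ℝ) (L : ℝ) (u : ℝ → ℝ) (x : ℝ) : ℝ :=
  ∑ i ∈ Finset.Ico 1 m,
    ((c i - a i) / L * (u (max 0 (min L ((x - a i) / ((c i - a i) / L)))) - u 0) +
      (a (i + 1) - c i) / (1 - L) *
        (u (max L (min 1 (L + (x - c i) / ((a (i + 1) - c i) / (1 - L))))) - u L))

lemma continuous_rescale {u : ℝ → ℝ} (hu : Continuous u) (L : ℝ) :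
    Continuous (rescale m a c L u) := by
  unfold rescale
  fun_prop

lemma left_ratio_le {A B L x : ℝ} (hAB : A < B) (hL : 0 < L) (hx : x ≤ A) :
    max 0 (min L ((x - A) / ((B - A) / L))) = 0 := by
  refine max_eq_left ((min_le_right _ _).trans ?_)
  exact div_nonpos_of_nonpos_of_nonneg (by linarith) (div_nonneg (by linarith) hL.le)

lemma left_ratio_ge {A B L x : ℝ} (hAB : A < B) (hL : 0 < L) (hx : B ≤ x) :
    max 0 (min L ((x - A) / ((B - A) / L))) = L := by
  have h1 : 0 < B - A := by linarith
  rw [min_eq_left, max_eq_right hL.le]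
  rw [le_div_iff₀ (by positivity), mul_div_cancel₀ _ hL.ne']
  linarith

lemma left_ratio_mem {A B L x : ℝ} (hAB : A < B) (hL : 0 < L) (hx : x ∈ Icc A B) :
    (x - A) / ((B - A) / L) ∈ Icc 0 L := by
  have h1 : 0 < B - A := by linarith
  refine ⟨div_nonneg (by linarith [hx.1]) (by positivity), ?_⟩
  rw [div_le_iff₀ (by positivity), mul_div_cancel₀ _ hL.ne']
  linarith [hx.2]

lemma right_ratio_le {A B L x : ℝ} (hAB : A < B) (hL : L < 1) (hx : x ≤ A) :
    max L (min 1 (L + (x - A) / ((B - A) / (1 - L)))) = L := by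
  refine max_eq_left ((min_le_right _ _).trans ?_)
  have := div_nonpos_of_nonpos_of_nonneg (by linarith : x - A ≤ 0)
    (div_nonneg (by linarith : 0 ≤ B - A) (by linarith : 0 ≤ 1 - L))
  linarith

lemma right_ratio_ge {A B L x : ℝ} (hAB : A < B) (hL : L < 1) (hx : B ≤ x) :
    max L (min 1 (L + (x - A) / ((B - A) / (1 - L)))) = 1 := by
  have h1 : 0 < B - A := by linarith
  have h2 : 0 < 1 - L := by linarith
  rw [min_eq_left, max_eq_right hL.le]
  rw [← sub_le_iff_le_add', le_div_iff₀ (by positivity), mul_div_cancel₀ _ h2.ne']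
  linarith

lemma right_ratio_mem {A B L x : ℝ} (hAB : A < B) (hL : L < 1) (hx : x ∈ Icc A B) :
    L + (x - A) / ((B - A) / (1 - L)) ∈ Icc L 1 := by
  have h1 : 0 < B - A := by linarith
  have h2 : 0 < 1 - L := by linarith
  have h3 : (x - A) / ((B - A) / (1 - L)) ≤ 1 - L := by
    rw [div_le_iff₀ (by positivity), mul_div_cancel₀ _ h2.ne']
    linarith [hx.2]
  exact ⟨le_add_of_nonneg_right (div_nonneg (by linarith [hx.1]) (by positivity)), by linarith⟩

/-- Across one period of nodes, only the summand of that period varies. -/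
lemma rescale_sub (hV : IsOscillatingPL m a c V) {L : ℝ} (hL0 : 0 < L) (hL1 : L < 1) (u : ℝ → ℝ)
    {i : ℕ} (hi : i ∈ Finset.Ico 1 m) {x y : ℝ} (hx : x ∈ Icc (a i) (a (i + 1)))
    (hy : y ∈ Icc (a i) (a (i + 1))) :
    rescale m a c L u x - rescale m a c L u y =
      (c i - a i) / L * (u (max 0 (min L ((x - a i) / ((c i - a i) / L)))) -
        u (max 0 (min L ((y - a i) / ((c i - a i) / L))))) +
      (a (i + 1) - c i) / (1 - L) *
        (u (max L (min 1 (L + (x - c i) / ((a (i + 1) - c i) / (1 - L))))) -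
          u (max L (min 1 (L + (y - c i) / ((a (i + 1) - c i) / (1 - L)))))) := by
  rw [rescale, rescale, ← Finset.sum_sub_distrib, Finset.sum_eq_single_of_mem i hi]
  · ring
  intro j hj hji
  have h1 := hV.lt_c j hj
  have h2 := hV.c_lt j hj
  have hi' := Finset.mem_Ico.1 hi
  have hj' := Finset.mem_Ico.1 hj
  rcases lt_or_gt_of_ne hji with hlt | hgt
  · have h3 : a (j + 1) ≤ a i := hV.node_le (by omega) hlt (by omega)
    rw [left_ratio_ge h1 hL0 (by linarith [hx.1]), left_ratio_ge h1 hL0 (by linarith [hy.1]),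
      right_ratio_ge h2 hL1 (by linarith [hx.1]), right_ratio_ge h2 hL1 (by linarith [hy.1])]
    ring
  · have h3 : a (i + 1) ≤ a j := hV.node_le (by omega) hgt (by omega)
    rw [left_ratio_le h1 hL0 (by linarith [hx.2]), left_ratio_le h1 hL0 (by linarith [hy.2]),
      right_ratio_le h2 hL1 (by linarith [hx.2]), right_ratio_le h2 hL1 (by linarith [hy.2])]
    ring

lemma rescale_sub_left (hV : IsOscillatingPL m a c V) {L : ℝ} (hL0 : 0 < L) (hL1 : L < 1)
    (u : ℝ → ℝ) {i : ℕ} (hi : i ∈ Finset.Ico 1 m) {x y : ℝ} (hx : x ∈ Icc (a i) (c i))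
    (hy : y ∈ Icc (a i) (c i)) :
    rescale m a c L u x - rescale m a c L u y = (c i - a i) / L *
      (u (0 + (x - a i) / ((c i - a i) / L)) - u (0 + (y - a i) / ((c i - a i) / L))) := by
  have h1 := hV.lt_c i hi
  have h2 := hV.c_lt i hi
  have hx' := left_ratio_mem h1 hL0 hx
  have hy' := left_ratio_mem h1 hL0 hy
  rw [hV.rescale_sub hL0 hL1 u hi ⟨hx.1, hx.2.trans h2.le⟩ ⟨hy.1, hy.2.trans h2.le⟩,
    right_ratio_le h2 hL1 hx.2, right_ratio_le h2 hL1 hy.2, min_eq_right hx'.2,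
    min_eq_right hy'.2, max_eq_right hx'.1, max_eq_right hy'.1, zero_add, zero_add]
  ring

lemma rescale_sub_right (hV : IsOscillatingPL m a c V) {L : ℝ} (hL0 : 0 < L) (hL1 : L < 1)
    (u : ℝ → ℝ) {i : ℕ} (hi : i ∈ Finset.Ico 1 m) {x y : ℝ} (hx : x ∈ Icc (c i) (a (i + 1)))
    (hy : y ∈ Icc (c i) (a (i + 1))) :
    rescale m a c L u x - rescale m a c L u y = (a (i + 1) - c i) / (1 - L) *
      (u (L + (x - c i) / ((a (i + 1) - c i) / (1 - L))) -
        u (L + (y - c i) / ((a (i + 1) - c i) / (1 - L)))) := by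
  have h1 := hV.lt_c i hi
  have h2 := hV.c_lt i hi
  have hx' := right_ratio_mem h2 hL1 hx
  have hy' := right_ratio_mem h2 hL1 hy
  rw [hV.rescale_sub hL0 hL1 u hi ⟨h1.le.trans hx.1, hx.2⟩ ⟨h1.le.trans hy.1, hy.2⟩,
    left_ratio_ge h1 hL0 hx.1, left_ratio_ge h1 hL0 hy.1, min_eq_right hx'.2,
    min_eq_right hy'.2, max_eq_right hx'.1, max_eq_right hy'.1]
  ring

lemma rescale_zero (hV : IsOscillatingPL m a c V) {L : ℝ} (hL0 : 0 < L) (hL1 : L < 1)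
    (u : ℝ → ℝ) : rescale m a c L u 0 = 0 := by
  refine Finset.sum_eq_zero fun i hi => ?_
  have hi' := Finset.mem_Ico.1 hi
  have h1 := hV.lt_c i hi
  have h0 : 0 ≤ a i := hV.first ▸ hV.node_le le_rfl hi'.1 hi'.2.le
  rw [left_ratio_le h1 hL0 h0, right_ratio_le (hV.c_lt i hi) hL1 (by linarith)]
  ring

/-- Under the balance condition the total increment is preserved. -/
lemma rescale_one (hV : IsOscillatingPL m a c V) {L : ℝ} (hL0 : 0 < L) (hL1 : L < 1)
    (hL : ∑ i ∈ Finset.Ico 1 m, (c i - a i) = L) (u : ℝ → ℝ) :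
    rescale m a c L u 1 = u 1 - u 0 := by
  have hterm : rescale m a c L u 1 = ∑ i ∈ Finset.Ico 1 m,
      ((c i - a i) / L * (u L - u 0) + (a (i + 1) - c i) / (1 - L) * (u 1 - u L)) := by
    refine Finset.sum_congr rfl fun i hi => ?_
    have hi' := Finset.mem_Ico.1 hi
    have h1 := hV.c_lt i hi
    have h0 : a (i + 1) ≤ 1 := hV.last ▸ hV.node_le (by omega) (by omega) le_rfl
    rw [left_ratio_ge (hV.lt_c i hi) hL0 (by linarith), right_ratio_ge h1 hL1 h0]
  rw [hterm, Finset.sum_add_distrib, ← Finset.sum_mul, ← Finset.sum_mul, ← Finset.sum_div,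
    ← Finset.sum_div, hV.sum_lengths, hL, div_self hL0.ne',
    div_self (by linarith : (1 - L) ≠ 0)]
  ring

/-- The sawtooth whose decreasing part has length `L` and the potential `V` whose decreasing pieces
have total length `L` have the same effective Hamiltonian: solutions can be rescaled piece by
piece, and the mean slope is preserved. -/
theorem cellSolvable_of_sawtooth (hV : IsOscillatingPL m a c V) {L : ℝ}
    (hL : ∑ i ∈ Finset.Ico 1 m, (c i - a i) = L) {H : ℝ → ℝ} {p b : ℝ}
    (h : CellSolvable H (sawtooth L) p b) : CellSolvable H V p b := by
  obtain ⟨v, hv⟩ := h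
  have hL0 : 0 < L := hL ▸ hV.length_pos
  have hL1 : L < 1 := hL ▸ hV.length_lt_one
  set u : ℝ → ℝ := fun z => p * z + v z with hu
  have hvc := hv.continuous
  have hu1 : ∀ z, u (z + 1) = u z + p := fun z => by
    simp only [hu, hv.periodic z]; ring
  set R := rescale m a c L u with hR
  have hR0 : R 0 = 0 := hV.rescale_zero hL0 hL1 u
  have hR1 : R 1 = p := by
    rw [hR, hV.rescale_one hL0 hL1 hL]
    have := hu1 0
    rw [zero_add] at this
    linarith
  have hRc : Continuous R := continuous_rescale (by fun_prop) L
  set w : ℝ → ℝ := fun x => R (Int.fract x) - p * Int.fract x with hw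
  have hwc : Continuous w :=
    ContinuousOn.comp_fract'' (f := fun x => R x - p * x) (by fun_prop) (by simp [hR0, hR1])
  have hwp : Function.Periodic w 1 := fun x => by simp [hw]
  set U : ℝ → ℝ := fun z => p * z + w z with hU
  have hUR : ∀ x ∈ Icc (0 : ℝ) 1, U x = R x := by
    intro x hx
    rcases hx.2.eq_or_lt with rfl | hlt
    · simp [hU, hw, hR0, hR1]
    · simp [hU, hw, Int.fract_eq_self.2 ⟨hx.1, hlt⟩]
  have hUn : ∀ (z : ℝ) (n : ℤ), U (z + n) = U z + n * p := fun z n => by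
    simp only [hU, hw, Int.fract_add_intCast]; ring
  have hnode : ∀ i ∈ Finset.Ico 1 m, 0 ≤ a i ∧ a (i + 1) ≤ 1 := fun i hi => by
    have hi' := Finset.mem_Ico.1 hi
    exact ⟨hV.first ▸ hV.node_le le_rfl hi'.1 hi'.2.le,
      hV.last ▸ hV.node_le (by omega) (by omega) le_rfl⟩
  have hleft : ∀ i ∈ Finset.Ico 1 m, _ := fun i hi =>
    copies_of_interval (U := U) (u := u) (z₀ := a i) (z₁ := c i) (w₀ := 0)
      (r := (c i - a i) / L) (div_pos (sub_pos.2 (hV.lt_c i hi)) hL0) (fun x hx y hy => by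
        have h0 := hnode i hi
        have h1 := hV.c_lt i hi
        rw [hUR x ⟨by linarith [hx.1], by linarith [hx.2]⟩,
          hUR y ⟨by linarith [hy.1], by linarith [hy.2]⟩]
        exact hV.rescale_sub_left hL0 hL1 u hi hx hy)
  have hright : ∀ i ∈ Finset.Ico 1 m, _ := fun i hi =>
    copies_of_interval (U := U) (u := u) (z₀ := c i) (z₁ := a (i + 1)) (w₀ := L)
      (r := (a (i + 1) - c i) / (1 - L)) (div_pos (sub_pos.2 (hV.c_lt i hi)) (sub_pos.2 hL1))
      (fun x hx y hy => by
        have h0 := hnode i hi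
        have h1 := hV.lt_c i hi
        rw [hUR x ⟨by linarith [hx.1], by linarith [hx.2]⟩,
          hUR y ⟨by linarith [hy.1], by linarith [hy.2]⟩]
        exact hV.rescale_sub_right hL0 hL1 u hi hx hy)
  have hcL : ∀ i ∈ Finset.Ico 1 m, 0 + (c i - a i) / ((c i - a i) / L) = L := fun i hi => by
    have := sub_pos.2 (hV.lt_c i hi)
    field_simp; ring
  have haL : ∀ i ∈ Finset.Ico 1 m,
      L + (a (i + 1) - c i) / ((a (i + 1) - c i) / (1 - L)) = 1 := fun i hi => by
    have h1 := sub_pos.2 (hV.c_lt i hi)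
    have h2 := sub_pos.2 hL1
    field_simp; ring
  -- the period of `u` identifies its behaviour at `1` with that at `0`
  have hnodeL : ∀ i ∈ Finset.Ico 1 m, IsLeftCopy U u (a (i + 1)) 0 := by
    intro i hi
    have h1 := (hright i hi).2 (a (i + 1)) ⟨hV.c_lt i hi, le_rfl⟩
    rw [haL i hi] at h1
    obtain ⟨r, hr, h2⟩ := h1
    refine ⟨r, hr, ?_⟩
    filter_upwards [h2] with k hk
    rw [hk]
    have e1 := hu1 k
    have e2 := hu1 0
    rw [zero_add] at e2 ⊢
    rw [add_comm 1 k, e1, e2]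
    ring
  have hzeroL : IsLeftCopy U u 0 0 := by
    have hm := hV.two_le
    have h1 := hnodeL (m - 1) (Finset.mem_Ico.2 ⟨by omega, by omega⟩)
    rw [Nat.sub_add_cancel (by omega), hV.last] at h1
    obtain ⟨r, hr, h2⟩ := h1
    refine ⟨r, hr, ?_⟩
    filter_upwards [h2] with k hk
    rw [← hk]
    have e1 := hUn (r * k) 1
    have e2 := hUn 0 1
    rw [Int.cast_one] at e1 e2
    rw [zero_add] at e2 ⊢
    rw [add_comm 1 (r * k), e1, e2]
    ring
  have hunit : ∀ x ∈ Ico (0 : ℝ) 1,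
      ∃ y, IsRightCopy U u x y ∧ IsLeftCopy U u x y ∧ V x = sawtooth L y := by
    intro x hx
    obtain ⟨i, hi, hix, hxi⟩ := hV.exists_piece hx
    have hi' := Finset.mem_Ico.1 hi
    have hac := hV.lt_c i hi
    have hca := hV.c_lt i hi
    have hVleft : ∀ z ∈ Icc (a i) (c i), V z = sawtooth L (0 + (z - a i) / ((c i - a i) / L)) := by
      intro z hz
      rw [hV.eq_on_left hi hz, zero_add, sawtooth_of_le hL1 (left_ratio_mem hac hL0 hz)]
      have := sub_pos.2 hac
      field_simp
    have hVright : ∀ z ∈ Icc (c i) (a (i + 1)),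
        V z = sawtooth L (L + (z - c i) / ((a (i + 1) - c i) / (1 - L))) := by
      intro z hz
      rw [hV.eq_on_right hi hz, sawtooth_of_ge hL0 hL1 (right_ratio_mem hca hL1 hz)]
      have h1 := sub_pos.2 hca
      have h2 := sub_pos.2 hL1
      field_simp
      ring
    rcases hix.eq_or_lt with rfl | hix
    · refine ⟨0, ?_, ?_, ?_⟩
      · simpa using (hleft i hi).1 (a i) ⟨le_rfl, hac⟩
      · rcases hi'.1.eq_or_lt with rfl | h1
        · rw [hV.first]; exact hzeroL
        · have := hnodeL (i - 1) (Finset.mem_Ico.2 ⟨by omega, by omega⟩)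
          rwa [Nat.sub_add_cancel (by omega)] at this
      · simpa using hVleft (a i) ⟨le_rfl, hac.le⟩
    rcases lt_trichotomy x (c i) with hxc | rfl | hxc
    · exact ⟨_, (hleft i hi).1 x ⟨hix.le, hxc⟩, (hleft i hi).2 x ⟨hix, hxc.le⟩,
        hVleft x ⟨hix.le, hxc.le⟩⟩
    · refine ⟨L, ?_, ?_, ?_⟩
      · simpa using (hright i hi).1 (c i) ⟨le_rfl, hca⟩
      · have := (hleft i hi).2 (c i) ⟨hac, le_rfl⟩
        rwa [hcL i hi] at this
      · simpa using hVright (c i) ⟨le_rfl, hca.le⟩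
    · exact ⟨_, (hright i hi).1 x ⟨hxc.le, hxi⟩, (hright i hi).2 x ⟨hxc, hxi.le⟩,
        hVright x ⟨hxc.le, hxi.le⟩⟩
  refine ⟨w, hv.of_copies hwc hwp fun x => ?_⟩
  obtain ⟨y, ⟨r, hr, h1⟩, ⟨l, hl, h2⟩, h3⟩ :=
    hunit (Int.fract x) ⟨Int.fract_nonneg x, Int.fract_lt_one x⟩
  have hshift : ∀ t, U (x + t) = U (Int.fract x + t) + ⌊x⌋ * p := fun t => by
    rw [← hUn]
    congr 1
    rw [Int.fract]; ring
  have hshift0 : U x = U (Int.fract x) + ⌊x⌋ * p := by simpa using hshift 0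
  refine ⟨y, ⟨r, hr, ?_⟩, ⟨l, hl, ?_⟩, ?_⟩
  · filter_upwards [h1] with k hk
    change U (x + r * k) - U x = r * (u (y + k) - u y)
    rw [← hk, hshift, hshift0]; ring
  · filter_upwards [h2] with k hk
    change U (x + l * k) - U x = l * (u (y + k) - u y)
    rw [← hk, hshift, hshift0]; ring
  · rw [← h3]
    have := hV.periodic.sub_int_mul_eq (x := x) ⌊x⌋
    rw [mul_one] at this
    exact this.symm

end IsOscillatingPL

/-! ### Generalized inverses of a profile -/

/-- A continuous coercive function on `[0,∞)` vanishing at `0`. -/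
structure IsCoerciveProfile (F : ℝ → ℝ) : Prop where
  continuousOn : ContinuousOn F (Ici 0)
  tendsto : Tendsto F atTop atTop
  zero : F 0 = 0

/-- The last point of `[0,∞)` at which `F` takes a value at most `t`. -/
noncomputable def upperInverse (F : ℝ → ℝ) (t : ℝ) : ℝ := sSup {q | q ∈ Ici 0 ∧ F q ≤ t}

/-- The first point of `[0,∞)` at which `F` takes a value at least `t`. -/
noncomputable def lowerInverse (F : ℝ → ℝ) (t : ℝ) : ℝ := sInf {q | q ∈ Ici 0 ∧ t ≤ F q}

namespace IsCoerciveProfile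

variable {F : ℝ → ℝ} {t q : ℝ}

lemma continuous_abs (hF : IsCoerciveProfile F) : Continuous fun p => F |p| :=
  hF.continuousOn.comp_continuous _root_.continuous_abs fun p => abs_nonneg p

lemma isCoerciveHamiltonian (hF : IsCoerciveProfile F) :
    IsCoerciveHamiltonian fun p => F |p| :=
  hF.tendsto.comp tendsto_norm_cocompact_atTop

lemma bddAbove_sublevel (hF : IsCoerciveProfile F) (t : ℝ) :
    BddAbove {q | q ∈ Ici 0 ∧ F q ≤ t} := by
  obtain ⟨N, hN⟩ := eventually_atTop.1 (hF.tendsto.eventually_gt_atTop t)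
  refine ⟨N, fun q hq => ?_⟩
  by_contra! h
  exact absurd hq.2 (not_le.2 (hN q h.le))

lemma bddBelow_superlevel (F : ℝ → ℝ) (t : ℝ) : BddBelow {q | q ∈ Ici 0 ∧ t ≤ F q} :=
  ⟨0, fun _ hq => hq.1⟩

lemma superlevel_nonempty (hF : IsCoerciveProfile F) (t : ℝ) :
    {q | q ∈ Ici 0 ∧ t ≤ F q}.Nonempty := by
  obtain ⟨N, h1, h2⟩ := ((hF.tendsto.eventually_ge_atTop t).and (eventually_ge_atTop 0)).exists
  exact ⟨N, h2, h1⟩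

lemma zero_mem_sublevel (hF : IsCoerciveProfile F) (ht : 0 ≤ t) :
    (0 : ℝ) ∈ {q | q ∈ Ici 0 ∧ F q ≤ t} := ⟨self_mem_Ici, by rwa [hF.zero]⟩

lemma upperInverse_nonneg (hF : IsCoerciveProfile F) (ht : 0 ≤ t) : 0 ≤ upperInverse F t :=
  le_csSup (hF.bddAbove_sublevel t) (hF.zero_mem_sublevel ht)

lemma lowerInverse_nonneg (hF : IsCoerciveProfile F) (t : ℝ) : 0 ≤ lowerInverse F t :=
  le_csInf (hF.superlevel_nonempty t) fun _ hq => hq.1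

lemma lt_of_upperInverse_lt (hF : IsCoerciveProfile F) (hq0 : 0 ≤ q) (hq : upperInverse F t < q) :
    t < F q := by
  by_contra! h
  exact absurd (le_csSup (hF.bddAbove_sublevel t) ⟨hq0, h⟩) (not_le.2 hq)

lemma lt_of_lt_lowerInverse (hq0 : 0 ≤ q) (hq : q < lowerInverse F t) : F q < t := by
  by_contra! h
  exact absurd (csInf_le (bddBelow_superlevel F t) ⟨hq0, h⟩) (not_le.2 hq)

lemma apply_upperInverse (hF : IsCoerciveProfile F) (ht : 0 ≤ t) : F (upperInverse F t) = t := by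
  have hmem : upperInverse F t ∈ {q | q ∈ Ici 0 ∧ F q ≤ t} :=
    IsClosed.csSup_mem (hF.continuousOn.preimage_isClosed_of_isClosed isClosed_Ici isClosed_Iic)
      ⟨0, hF.zero_mem_sublevel ht⟩ (hF.bddAbove_sublevel t)
  refine le_antisymm hmem.2 ?_
  have h1 : Tendsto F (𝓝[>] upperInverse F t) (𝓝 (F (upperInverse F t))) :=
    (hF.continuousOn _ hmem.1).mono fun q hq => (show (0 : ℝ) ≤ q from hmem.1.trans (le_of_lt hq))
  refine ge_of_tendsto h1 ?_
  filter_upwards [self_mem_nhdsWithin] with q hq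
  exact (hF.lt_of_upperInverse_lt (hmem.1.trans (le_of_lt hq)) hq).le

lemma apply_lowerInverse (hF : IsCoerciveProfile F) (ht : 0 ≤ t) : F (lowerInverse F t) = t := by
  have hmem : lowerInverse F t ∈ {q | q ∈ Ici 0 ∧ t ≤ F q} :=
    IsClosed.csInf_mem (hF.continuousOn.preimage_isClosed_of_isClosed isClosed_Ici isClosed_Ici)
      (hF.superlevel_nonempty t) (bddBelow_superlevel F t)
  obtain ⟨q, hq, hqt⟩ := intermediate_value_Icc hmem.1
    (hF.continuousOn.mono Icc_subset_Ici_self) ⟨by rwa [hF.zero], hmem.2⟩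
  have h1 : lowerInverse F t ≤ q := csInf_le (bddBelow_superlevel F t) ⟨hq.1, hqt.ge⟩
  rwa [← le_antisymm h1 hq.2] at hqt

lemma le_apply_of_upperInverse_le (hF : IsCoerciveProfile F) (ht : 0 ≤ t)
    (hq : upperInverse F t ≤ q) : t ≤ F q := by
  rcases hq.eq_or_lt with rfl | hlt
  · exact (hF.apply_upperInverse ht).ge
  · exact (hF.lt_of_upperInverse_lt ((hF.upperInverse_nonneg ht).trans hq) hlt).le

lemma apply_le_of_le_lowerInverse (hF : IsCoerciveProfile F) (ht : 0 ≤ t) (hq0 : 0 ≤ q)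
    (hq : q ≤ lowerInverse F t) : F q ≤ t := by
  rcases hq.eq_or_lt with rfl | hlt
  · exact (hF.apply_lowerInverse ht).le
  · exact (lt_of_lt_lowerInverse hq0 hlt).le

lemma monotoneOn_upperInverse (hF : IsCoerciveProfile F) :
    MonotoneOn (upperInverse F) (Ici 0) := fun _ ht t' _ htt' =>
  csSup_le_csSup (hF.bddAbove_sublevel t') ⟨0, hF.zero_mem_sublevel ht⟩
    fun _ hq => ⟨hq.1, hq.2.trans htt'⟩

lemma monotone_lowerInverse (hF : IsCoerciveProfile F) :
    Monotone (lowerInverse F) := fun t t' htt' =>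
  csInf_le_csInf (bddBelow_superlevel F t) (hF.superlevel_nonempty t')
    fun _ hq => ⟨hq.1, htt'.trans hq.2⟩

lemma lowerInverse_le_upperInverse (hF : IsCoerciveProfile F) (ht : 0 ≤ t) :
    lowerInverse F t ≤ upperInverse F t :=
  csInf_le (bddBelow_superlevel F t) ⟨hF.upperInverse_nonneg ht, (hF.apply_upperInverse ht).ge⟩

lemma intervalIntegrable_upperInverse (hF : IsCoerciveProfile F) {x y : ℝ} (hx : 0 ≤ x)
    (hy : 0 ≤ y) : IntervalIntegrable (upperInverse F) MeasureTheory.volume x y :=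
  (hF.monotoneOn_upperInverse.mono fun _ hz => (le_min hx hy).trans hz.1).intervalIntegrable

lemma intervalIntegrable_lowerInverse (hF : IsCoerciveProfile F) (x y : ℝ) :
    IntervalIntegrable (lowerInverse F) MeasureTheory.volume x y :=
  hF.monotone_lowerInverse.intervalIntegrable

end IsCoerciveProfile

namespace IsNonconvexProfile

variable {F : ℝ → ℝ}

lemma isCoerciveProfile (hF : IsNonconvexProfile F) : IsCoerciveProfile F := by
  obtain ⟨h1, h2, θ₁, θ₂, θ₃, -, -, -, h3, -⟩ := hF
  exact ⟨h1, h2, h3⟩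

/-- Below the level of the local minimum there is only one branch. -/
lemma upperInverse_eq_lowerInverse_of_lt (hF : IsNonconvexProfile F) {t : ℝ} (ht0 : 0 ≤ t)
    (ht : t < 1 / 3) : upperInverse F t = lowerInverse F t := by
  have hP := hF.isCoerciveProfile
  obtain ⟨-, -, θ₁, θ₂, θ₃, h3, h32, h21, -, hF2, hF1, hF3, hm, hm', ha⟩ := hF
  have hsmall : ∀ q, 0 ≤ q → F q = t → q ∈ Icc 0 θ₂ := by
    intro q hq0 hq
    refine ⟨hq0, ?_⟩
    by_contra! hlt
    rcases le_total q θ₁ with h | h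
    · have := ha.antitoneOn ⟨hlt.le, h⟩ ⟨h21.le, le_rfl⟩ h
      linarith
    · have := hm'.monotoneOn self_mem_Ici h h
      linarith
  have e1 := hP.apply_upperInverse ht0
  have e2 := hP.apply_lowerInverse ht0
  exact hm.injOn (hsmall _ (hP.upperInverse_nonneg ht0) e1) (hsmall _ (hP.lowerInverse_nonneg t) e2)
    (e1.trans e2.symm)

/-- Above the level of the local maximum there is only one branch. -/
lemma upperInverse_one_eq_lowerInverse_one (hF : IsNonconvexProfile F) :
    upperInverse F 1 = lowerInverse F 1 := by
  have hP := hF.isCoerciveProfile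
  obtain ⟨-, -, θ₁, θ₂, θ₃, h3, h32, h21, -, hF2, hF1, hF3, hm, hm', ha⟩ := hF
  have hlarge : ∀ q, 0 ≤ q → F q = 1 → q ∈ Ici θ₁ := by
    intro q hq0 hq
    by_contra hlt
    rw [mem_Ici, not_le] at hlt
    rcases le_total q θ₂ with h | h
    · have := hm.monotoneOn ⟨hq0, h⟩ ⟨by linarith, le_rfl⟩ h
      linarith
    · have := ha.antitoneOn ⟨le_rfl, h21.le⟩ ⟨h, hlt.le⟩ h
      linarith
  have e1 := hP.apply_upperInverse zero_le_one
  have e2 := hP.apply_lowerInverse zero_le_one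
  exact hm'.injOn (hlarge _ (hP.upperInverse_nonneg zero_le_one) e1)
    (hlarge _ (hP.lowerInverse_nonneg 1) e2) (e1.trans e2.symm)

/-- Between the levels of the local minimum and of the local maximum the extreme branches differ. -/
lemma lowerInverse_lt_upperInverse (hF : IsNonconvexProfile F) {t : ℝ}
    (ht : t ∈ Ioo (1 / 3 : ℝ) (1 / 2)) : lowerInverse F t < upperInverse F t := by
  have hP := hF.isCoerciveProfile
  obtain ⟨-, -, θ₁, θ₂, θ₃, h3, h32, h21, -, hF2, hF1, hF3, hm, hm', ha⟩ := hF
  have h1 : lowerInverse F t ≤ θ₂ :=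
    csInf_le (IsCoerciveProfile.bddBelow_superlevel F t)
      ⟨(by linarith : (0 : ℝ) ≤ θ₂), by linarith [ht.2]⟩
  have h2 : θ₁ ≤ upperInverse F t :=
    le_csSup (hP.bddAbove_sublevel t) ⟨(by linarith : (0 : ℝ) ≤ θ₁), by linarith [ht.1]⟩
  linarith

lemma integral_lowerInverse_lt (hF : IsNonconvexProfile F) :
    ∫ t in (0 : ℝ)..1, lowerInverse F t < ∫ t in (0 : ℝ)..1, upperInverse F t := by
  have hP := hF.isCoerciveProfile
  have hi : ∀ x y : ℝ, 0 ≤ x → 0 ≤ y → IntervalIntegrable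
      (fun t => upperInverse F t - lowerInverse F t) MeasureTheory.volume x y := fun x y hx hy =>
    (hP.intervalIntegrable_upperInverse hx hy).sub (hP.intervalIntegrable_lowerInverse x y)
  have hnn : ∀ x y : ℝ, 0 ≤ x → x ≤ y →
      0 ≤ ∫ t in x..y, (upperInverse F t - lowerInverse F t) := fun x y hx hxy =>
    intervalIntegral.integral_nonneg hxy fun t ht =>
      sub_nonneg.2 (hP.lowerInverse_le_upperInverse (hx.trans ht.1))
  have hpos : 0 < ∫ t in (1 / 3 : ℝ)..(1 / 2), (upperInverse F t - lowerInverse F t) :=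
    intervalIntegral.intervalIntegral_pos_of_pos_on (hi _ _ (by norm_num) (by norm_num))
      (fun t ht => sub_pos.2 (hF.lowerInverse_lt_upperInverse ht)) (by norm_num)
  rw [← sub_pos, ← intervalIntegral.integral_sub
    (hP.intervalIntegrable_upperInverse le_rfl zero_le_one)
    (hP.intervalIntegrable_lowerInverse 0 1),
    ← intervalIntegral.integral_add_adjacent_intervals (b := 1 / 3)
      (hi _ _ le_rfl (by norm_num)) (hi _ _ (by norm_num) zero_le_one),
    ← intervalIntegral.integral_add_adjacent_intervals (a := 1 / 3) (b := 1 / 2)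
      (hi _ _ (by norm_num) (by norm_num)) (hi _ _ (by norm_num) zero_le_one)]
  have h1 := hnn 0 (1 / 3) le_rfl (by norm_num)
  have h2 := hnn (1 / 2) 1 (by norm_num) (by norm_num)
  linarith

end IsNonconvexProfile

/-! ### Test slopes of primitives -/

lemma le_of_hasDerivAt_of_right {θ : ℝ → ℝ} {d x b : ℝ} (hd : HasDerivAt θ d x)
    (h : ∀ᶠ y in 𝓝[>] x, b * (y - x) ≤ θ y - θ x) : b ≤ d := by
  refine ge_of_tendsto ((hasDerivWithinAt_iff_tendsto_slope' self_notMem_Ioi).1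
    (hd.hasDerivWithinAt (s := Ioi x))) ?_
  filter_upwards [h, self_mem_nhdsWithin] with y hy hxy
  rw [slope_def_field, le_div_iff₀ (sub_pos.2 hxy)]
  exact hy

lemma le_of_hasDerivAt_of_left {θ : ℝ → ℝ} {d x b : ℝ} (hd : HasDerivAt θ d x)
    (h : ∀ᶠ y in 𝓝[<] x, b * (x - y) ≤ θ x - θ y) : b ≤ d := by
  refine ge_of_tendsto ((hasDerivWithinAt_iff_tendsto_slope' self_notMem_Iio).1
    (hd.hasDerivWithinAt (s := Iio x))) ?_
  filter_upwards [h, self_mem_nhdsWithin] with y hy hxy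
  rw [slope_comm, slope_def_field, le_div_iff₀ (sub_pos.2 hxy)]
  exact hy

section Primitive

open MeasureTheory

variable {g φ : ℝ → ℝ} {x b P : ℝ}

/-- The `1`-periodic function whose sum with `P x`, for `P` the mean of the periodic function `g`,
is the primitive of `g`. -/
noncomputable def corrector (g : ℝ → ℝ) (x : ℝ) : ℝ :=
  (∫ t in (0 : ℝ)..x, g t) - (∫ t in (0 : ℝ)..1, g t) * x

lemma continuous_corrector (hg : ∀ x y, IntervalIntegrable g volume x y) :
    Continuous (corrector g) :=
  (intervalIntegral.continuous_primitive hg 0).sub (by fun_prop)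

lemma periodic_corrector (hg : ∀ x y, IntervalIntegrable g volume x y)
    (hp : Function.Periodic g 1) : Function.Periodic (corrector g) 1 := by
  intro x
  have h1 := intervalIntegral.integral_add_adjacent_intervals (hg 0 x) (hg x (x + 1))
  have h2 := hp.intervalIntegral_add_eq x 0
  rw [zero_add] at h2
  simp only [corrector]
  rw [← h1, h2]
  ring

lemma corrector_sub (hg : ∀ x y, IntervalIntegrable g volume x y) (x y : ℝ) :
    corrector g y - corrector g x = (∫ t in x..y, g t) - (∫ t in (0 : ℝ)..1, g t) * (y - x) := by
  have h1 := intervalIntegral.integral_add_adjacent_intervals (hg 0 x) (hg x y)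
  simp only [corrector]
  rw [← h1]
  ring

lemma eventually_right_le_integral (hg : ∀ x y, IntervalIntegrable g volume x y)
    (h : ∀ᶠ y in 𝓝[>] x, b ≤ g y) : ∀ᶠ y in 𝓝[>] x, b * (y - x) ≤ ∫ t in x..y, g t := by
  obtain ⟨r, hr, hsub⟩ := mem_nhdsGT_iff_exists_Ioo_subset.1 h
  filter_upwards [Ioo_mem_nhdsGT hr] with y hy
  have := intervalIntegral.integral_mono_on_of_le_Ioo hy.1.le
    (intervalIntegrable_const (c := b)) (hg x y)
    fun z hz => hsub ⟨hz.1, hz.2.trans hy.2⟩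
  rw [intervalIntegral.integral_const, smul_eq_mul] at this
  linarith

lemma eventually_left_le_integral (hg : ∀ x y, IntervalIntegrable g volume x y)
    (h : ∀ᶠ y in 𝓝[<] x, b ≤ g y) : ∀ᶠ y in 𝓝[<] x, b * (x - y) ≤ ∫ t in y..x, g t := by
  obtain ⟨l, hl, hsub⟩ := mem_nhdsLT_iff_exists_Ioo_subset.1 h
  filter_upwards [Ioo_mem_nhdsLT hl] with y hy
  have := intervalIntegral.integral_mono_on_of_le_Ioo hy.2.le
    (intervalIntegrable_const (c := b)) (hg y x)
    fun z hz => hsub ⟨hy.1.trans hz.1, hz.2⟩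
  rw [intervalIntegral.integral_const, smul_eq_mul] at this
  linarith

/-- The slope `P + φ' x` of a test function for a primitive of `g`. -/
lemma hasDerivAt_test (hφ : ContDiff ℝ 1 φ) (P x : ℝ) :
    HasDerivAt (fun z => P * z + φ z) (P + deriv φ x) x :=
  HasDerivAt.fun_add (by simpa using (hasDerivAt_id x).const_mul P)
    (hφ.differentiable one_ne_zero x).hasDerivAt

lemma le_slope_of_isLocalMax (hg : ∀ x y, IntervalIntegrable g volume x y) (hφ : ContDiff ℝ 1 φ)
    (hx : IsLocalMax (fun y => corrector g y - φ y) x) (h : ∀ᶠ y in 𝓝[>] x, b ≤ g y) :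
    b ≤ (∫ t in (0 : ℝ)..1, g t) + deriv φ x := by
  refine le_of_hasDerivAt_of_right (hasDerivAt_test hφ _ x) ?_
  filter_upwards [eventually_right_le_integral hg h, nhdsWithin_le_nhds hx] with y h1 h2
  linarith [corrector_sub hg x y]

lemma slope_le_of_isLocalMax (hg : ∀ x y, IntervalIntegrable g volume x y) (hφ : ContDiff ℝ 1 φ)
    (hx : IsLocalMax (fun y => corrector g y - φ y) x) (h : ∀ᶠ y in 𝓝[<] x, g y ≤ b) :
    (∫ t in (0 : ℝ)..1, g t) + deriv φ x ≤ b := by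
  rw [← neg_le_neg_iff]
  refine le_of_hasDerivAt_of_left (hasDerivAt_test hφ _ x).fun_neg ?_
  have hneg : ∀ᶠ y in 𝓝[<] x, -b ≤ -g y := by
    filter_upwards [h] with y hy
    linarith
  filter_upwards [eventually_left_le_integral (g := fun z => -g z) (fun x y => (hg x y).neg) hneg,
    nhdsWithin_le_nhds hx] with y h1 h2
  rw [intervalIntegral.integral_neg] at h1
  linarith [corrector_sub hg y x]

lemma le_slope_of_isLocalMin (hg : ∀ x y, IntervalIntegrable g volume x y) (hφ : ContDiff ℝ 1 φ)
    (hx : IsLocalMin (fun y => corrector g y - φ y) x) (h : ∀ᶠ y in 𝓝[<] x, b ≤ g y) :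
    b ≤ (∫ t in (0 : ℝ)..1, g t) + deriv φ x := by
  refine le_of_hasDerivAt_of_left (hasDerivAt_test hφ _ x) ?_
  filter_upwards [eventually_left_le_integral hg h, nhdsWithin_le_nhds hx] with y h1 h2
  linarith [corrector_sub hg y x]

lemma slope_le_of_isLocalMin (hg : ∀ x y, IntervalIntegrable g volume x y) (hφ : ContDiff ℝ 1 φ)
    (hx : IsLocalMin (fun y => corrector g y - φ y) x) (h : ∀ᶠ y in 𝓝[>] x, g y ≤ b) :
    (∫ t in (0 : ℝ)..1, g t) + deriv φ x ≤ b := by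
  rw [← neg_le_neg_iff]
  refine le_of_hasDerivAt_of_right (hasDerivAt_test hφ _ x).fun_neg ?_
  have hneg : ∀ᶠ y in 𝓝[>] x, -b ≤ -g y := by
    filter_upwards [h] with y hy
    linarith
  filter_upwards [eventually_right_le_integral (g := fun z => -g z) (fun x y => (hg x y).neg) hneg,
    nhdsWithin_le_nhds hx] with y h1 h2
  rw [intervalIntegral.integral_neg] at h1
  linarith [corrector_sub hg x y]

end Primitive

/-! ### The sawtooth near a point -/

lemma fract_eq_sub_of_mem {y : ℝ} {n : ℤ} (h1 : (n : ℝ) ≤ y) (h2 : y < n + 1) :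
    Int.fract y = y - n :=
  Int.fract_eq_iff.2 ⟨by linarith, by linarith, n, by ring⟩

lemma sawtooth_fract (s x : ℝ) : sawtooth s (Int.fract x) = sawtooth s x := by
  simp [sawtooth]

section Sawtooth

variable {s x : ℝ}

lemma sawtooth_eq_left (hs1 : s < 1) (hx : Int.fract x ≤ s) :
    sawtooth s x = -(Int.fract x / s) := by
  rw [← sawtooth_fract, sawtooth_of_le hs1 ⟨Int.fract_nonneg x, hx⟩]

lemma sawtooth_eq_right (hs0 : 0 < s) (hs1 : s < 1) (hx : s ≤ Int.fract x) :
    sawtooth s x = (Int.fract x - 1) / (1 - s) := by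
  rw [← sawtooth_fract, sawtooth_of_ge hs0 hs1 ⟨hx, (Int.fract_lt_one x).le⟩]

lemma sawtooth_nonpos (hs0 : 0 < s) (hs1 : s < 1) (x : ℝ) : sawtooth s x ≤ 0 := by
  rcases le_total (Int.fract x) s with h | h
  · rw [sawtooth_eq_left hs1 h]
    exact neg_nonpos.2 (div_nonneg (Int.fract_nonneg x) hs0.le)
  · rw [sawtooth_eq_right hs0 hs1 h]
    exact div_nonpos_of_nonpos_of_nonneg (by linarith [Int.fract_lt_one x]) (by linarith)

lemma sawtooth_eventually_left_decreasing (hs0 : 0 < s) (hs1 : s < 1) (hx0 : 0 < Int.fract x)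
    (hxs : Int.fract x ≤ s) :
    ∀ᶠ y in 𝓝[<] x, Int.fract y ≤ s ∧ sawtooth s x ≤ sawtooth s y := by
  have hf : Int.fract x = x - ⌊x⌋ := rfl
  filter_upwards [Ioo_mem_nhdsLT (show (⌊x⌋ : ℝ) < x by linarith)] with y hy
  have hy' : Int.fract y = y - ⌊x⌋ := fract_eq_sub_of_mem hy.1.le (by linarith [hy.2])
  have hys : Int.fract y ≤ s := by linarith [hy.2]
  refine ⟨hys, ?_⟩
  rw [sawtooth_eq_left hs1 hxs, sawtooth_eq_left hs1 hys, neg_le_neg_iff]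
  gcongr
  linarith [hy.2]

lemma sawtooth_eventually_right_decreasing (hs0 : 0 < s) (hs1 : s < 1) (hxs : Int.fract x < s) :
    ∀ᶠ y in 𝓝[>] x, Int.fract y ≤ s ∧ sawtooth s y ≤ sawtooth s x := by
  have hf : Int.fract x = x - ⌊x⌋ := rfl
  have hx0 := Int.fract_nonneg x
  filter_upwards [Ioo_mem_nhdsGT (show x < ⌊x⌋ + s by linarith)] with y hy
  have hy' : Int.fract y = y - ⌊x⌋ :=
    fract_eq_sub_of_mem (by linarith [hy.1]) (by linarith [hy.2])
  have hys : Int.fract y ≤ s := by linarith [hy.2]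
  refine ⟨hys, ?_⟩
  rw [sawtooth_eq_left hs1 hxs.le, sawtooth_eq_left hs1 hys, neg_le_neg_iff]
  gcongr
  linarith [hy.1]

lemma sawtooth_eventually_left_increasing (hs0 : 0 < s) (hs1 : s < 1)
    (hx : Int.fract x = 0 ∨ s < Int.fract x) :
    ∀ᶠ y in 𝓝[<] x, s < Int.fract y ∧ sawtooth s y ≤ sawtooth s x := by
  have hf : Int.fract x = x - ⌊x⌋ := rfl
  have hx1 := Int.fract_lt_one x
  rcases hx with hx | hx
  · have hVx : sawtooth s x = 0 := by rw [sawtooth_eq_left hs1 (by linarith), hx]; simp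
    filter_upwards [Ioo_mem_nhdsLT (show x - (1 - s) < x by linarith)] with y hy
    have hy' : Int.fract y = y - ((⌊x⌋ - 1 : ℤ) : ℝ) := fract_eq_sub_of_mem
      (by push_cast; linarith [hy.1]) (by push_cast; linarith [hy.2])
    push_cast at hy'
    refine ⟨by linarith [hy.1], ?_⟩
    rw [hVx]
    exact sawtooth_nonpos hs0 hs1 y
  · filter_upwards [Ioo_mem_nhdsLT (show ⌊x⌋ + s < x by linarith)] with y hy
    have hy' : Int.fract y = y - ⌊x⌋ :=
      fract_eq_sub_of_mem (by linarith [hy.1]) (by linarith [hy.2])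
    have hys : s < Int.fract y := by linarith [hy.1]
    refine ⟨hys, ?_⟩
    rw [sawtooth_eq_right hs0 hs1 hx.le, sawtooth_eq_right hs0 hs1 hys.le]
    have : 0 < 1 - s := by linarith
    gcongr
    linarith [hy.2]

lemma sawtooth_eventually_right_increasing (hs0 : 0 < s) (hs1 : s < 1) (hxs : s ≤ Int.fract x) :
    ∀ᶠ y in 𝓝[>] x, s < Int.fract y ∧ sawtooth s x ≤ sawtooth s y := by
  have hf : Int.fract x = x - ⌊x⌋ := rfl
  have hx1 := Int.fract_lt_one x
  filter_upwards [Ioo_mem_nhdsGT (show x < ⌊x⌋ + 1 by linarith)] with y hy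
  have hy' : Int.fract y = y - ⌊x⌋ :=
    fract_eq_sub_of_mem (by linarith [hy.1]) (by linarith [hy.2])
  have hys : s < Int.fract y := by linarith [hy.1]
  refine ⟨hys, ?_⟩
  rw [sawtooth_eq_right hs0 hs1 hxs, sawtooth_eq_right hs0 hs1 hys.le]
  have : 0 < 1 - s := by linarith
  gcongr
  linarith [hy.1]

end Sawtooth

/-! ### Explicit sub- and supersolutions for the sawtooth -/

/-- The slope at `x` of the explicit solution at level `b`: it follows the upper branch where the
sawtooth decreases and the lower branch where it increases. Raising the slope by the constant `A`
on the decreasing part keeps the supersolution property and adjusts the mean slope. -/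
noncomputable def sawtoothSlope (F : ℝ → ℝ) (s b A x : ℝ) : ℝ :=
  if Int.fract x ≤ s then upperInverse F (b - sawtooth s x) + A
  else lowerInverse F (b - sawtooth s x)

lemma periodic_sawtoothSlope (F : ℝ → ℝ) (s b A : ℝ) :
    Function.Periodic (sawtoothSlope F s b A) 1 := fun x => by
  simp [sawtoothSlope, sawtooth]

section Slope

open MeasureTheory

variable {F : ℝ → ℝ} {s b A : ℝ}

lemma sawtoothSlope_of_le {x : ℝ} (hx : Int.fract x ≤ s) :
    sawtoothSlope F s b A x = upperInverse F (b - sawtooth s x) + A := if_pos hx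

lemma sawtoothSlope_of_lt {x : ℝ} (hx : s < Int.fract x) :
    sawtoothSlope F s b A x = lowerInverse F (b - sawtooth s x) := if_neg (not_le.2 hx)

lemma sawtoothSlope_eqOn_left (hs1 : s < 1) :
    EqOn (fun y => upperInverse F (b + y / s) + A) (sawtoothSlope F s b A) (Ioo 0 s) := by
  intro y hy
  have hf : Int.fract y = y := Int.fract_eq_self.2 ⟨hy.1.le, hy.2.trans hs1⟩
  have hle : Int.fract y ≤ s := hf.le.trans hy.2.le
  simp only [sawtoothSlope_of_le hle, sawtooth_eq_left hs1 hle, hf, sub_neg_eq_add]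

lemma sawtoothSlope_eqOn_right (hs0 : 0 < s) (hs1 : s < 1) :
    EqOn (fun y => lowerInverse F (b + 1 / (1 - s) - y / (1 - s))) (sawtoothSlope F s b A)
      (Ioo s 1) := by
  intro y hy
  have hf : Int.fract y = y := Int.fract_eq_self.2 ⟨hs0.le.trans hy.1.le, hy.2⟩
  have hlt : s < Int.fract y := hy.1.trans_eq hf.symm
  simp only [sawtoothSlope_of_lt hlt, sawtooth_eq_right hs0 hs1 hlt.le, hf]
  congr 1
  ring

lemma intervalIntegrable_left (hF : IsCoerciveProfile F) (hs0 : 0 < s) (hb : 0 ≤ b) :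
    IntervalIntegrable (fun y => upperInverse F (b + y / s)) volume 0 s := by
  refine MonotoneOn.intervalIntegrable fun y hy z hz hyz => ?_
  rw [uIcc_of_le hs0.le] at hy hz
  have hy0 := div_nonneg hy.1 hs0.le
  have hz0 := div_nonneg hz.1 hs0.le
  exact hF.monotoneOn_upperInverse (add_nonneg hb hy0) (add_nonneg hb hz0) (by gcongr)

lemma intervalIntegrable_right (hF : IsCoerciveProfile F) (hs1 : s < 1) (d x y : ℝ) :
    IntervalIntegrable (fun y => lowerInverse F (d - y / (1 - s))) volume x y := by
  refine Antitone.intervalIntegrable fun y z hyz => hF.monotone_lowerInverse ?_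
  have : 0 < 1 - s := by linarith
  gcongr

lemma intervalIntegrable_sawtoothSlope_left (hF : IsCoerciveProfile F) (hs0 : 0 < s) (hs1 : s < 1)
    (hb : 0 ≤ b) : IntervalIntegrable (sawtoothSlope F s b A) volume 0 s :=
  ((intervalIntegrable_left hF hs0 hb).add intervalIntegrable_const).congr_uIoo
    (uIoo_of_le hs0.le ▸ sawtoothSlope_eqOn_left hs1)

lemma intervalIntegrable_sawtoothSlope_right (hF : IsCoerciveProfile F) (hs0 : 0 < s)
    (hs1 : s < 1) : IntervalIntegrable (sawtoothSlope F s b A) volume s 1 :=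
  (intervalIntegrable_right hF hs1 _ _ _).congr_uIoo
    (uIoo_of_le hs1.le ▸ sawtoothSlope_eqOn_right hs0 hs1)

lemma intervalIntegrable_sawtoothSlope (hF : IsCoerciveProfile F) (hs0 : 0 < s) (hs1 : s < 1)
    (hb : 0 ≤ b) (x y : ℝ) : IntervalIntegrable (sawtoothSlope F s b A) volume x y :=
  (periodic_sawtoothSlope F s b A).intervalIntegrable₀ one_ne_zero
    ((intervalIntegrable_sawtoothSlope_left hF hs0 hs1 hb).trans
      (intervalIntegrable_sawtoothSlope_right hF hs0 hs1)) x y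

lemma integral_sawtoothSlope (hF : IsCoerciveProfile F) (hs0 : 0 < s) (hs1 : s < 1)
    (hb : 0 ≤ b) : ∫ x in (0 : ℝ)..1, sawtoothSlope F s b A x =
      s * ((∫ t in b..(b + 1), upperInverse F t) + A) +
        (1 - s) * ∫ t in b..(b + 1), lowerInverse F t := by
  have hs1' : 1 - s ≠ 0 := by linarith
  rw [← intervalIntegral.integral_add_adjacent_intervals
    (intervalIntegrable_sawtoothSlope_left hF hs0 hs1 hb)
    (intervalIntegrable_sawtoothSlope_right hF hs0 hs1),
    ← intervalIntegral.integral_congr_Ioo_of_le hs0.le (sawtoothSlope_eqOn_left hs1),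
    ← intervalIntegral.integral_congr_Ioo_of_le hs1.le (sawtoothSlope_eqOn_right hs0 hs1),
    intervalIntegral.integral_add (intervalIntegrable_left hF hs0 hb) intervalIntegrable_const,
    intervalIntegral.integral_comp_add_div _ hs0.ne',
    intervalIntegral.integral_comp_sub_div _ hs1', intervalIntegral.integral_const]
  have e1 : b + 1 / (1 - s) - 1 / (1 - s) = b := by ring
  have e2 : b + 1 / (1 - s) - s / (1 - s) = b + 1 := by field_simp; ring
  rw [e1, e2, zero_div, add_zero, div_self hs0.ne']
  simp only [smul_eq_mul]
  ring

lemma sawtoothSlope_nonneg (hF : IsCoerciveProfile F) (hs0 : 0 < s) (hs1 : s < 1) (hb : 0 ≤ b)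
    (hA : 0 ≤ A) (x : ℝ) : 0 ≤ sawtoothSlope F s b A x := by
  rw [sawtoothSlope]
  split_ifs
  · exact add_nonneg (hF.upperInverse_nonneg (by linarith [sawtooth_nonpos hs0 hs1 x])) hA
  · exact hF.lowerInverse_nonneg _

/-- At level `0` the explicit function is a subsolution. At `x ∈ ℤ` the slope of a test function
touching from above is nonnegative and at most every `lowerInverse F t` with `t > 0`; at the other
corners both branches agree, because the level there lies above the local maximum of the profile.
-/
theorem corrector_sawtoothSlope_sub (hF : IsNonconvexProfile F) (hs0 : 0 < s) (hs1 : s < 1)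
    {φ : ℝ → ℝ} (hφ : ContDiff ℝ 1 φ) {x : ℝ}
    (hx : IsLocalMax (fun y => corrector (sawtoothSlope F s 0 0) y - φ y) x) :
    F |(∫ t in (0 : ℝ)..1, sawtoothSlope F s 0 0 t) + deriv φ x| + sawtooth s x ≤ 0 := by
  have hP := hF.isCoerciveProfile
  have hint := intervalIntegrable_sawtoothSlope (A := 0) hP hs0 hs1 le_rfl
  set q := (∫ t in (0 : ℝ)..1, sawtoothSlope F s 0 0 t) + deriv φ x with hq
  have hV := sawtooth_nonpos hs0 hs1
  have hVc := continuous_sawtooth hs0 hs1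
  have hq0 : 0 ≤ q := le_slope_of_isLocalMax hint hφ hx
    (Eventually.of_forall (sawtoothSlope_nonneg hP hs0 hs1 le_rfl le_rfl))
  rw [abs_of_nonneg hq0]
  suffices h : F q ≤ 0 - sawtooth s x by linarith
  have ht0 : 0 ≤ 0 - sawtooth s x := by linarith [hV x]
  by_cases hinc : Int.fract x = 0 ∨ s < Int.fract x
  · refine le_of_forall_pos_le_add fun ε hε => ?_
    refine hP.apply_le_of_le_lowerInverse (by linarith) hq0
      (slope_le_of_isLocalMax hint hφ hx ?_)
    filter_upwards [sawtooth_eventually_left_increasing hs0 hs1 hinc, nhdsWithin_le_nhds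
      (hVc.continuousAt.eventually_const_lt (show sawtooth s x - ε < sawtooth s x by linarith))]
      with y h1 h2
    rw [sawtoothSlope_of_lt h1.1]
    exact hP.monotone_lowerInverse (by linarith)
  · obtain ⟨hne, hle⟩ := not_or.1 hinc
    have hpos : 0 < Int.fract x := lt_of_le_of_ne (Int.fract_nonneg x) (Ne.symm hne)
    rw [not_lt] at hle
    have hqle : q ≤ upperInverse F (0 - sawtooth s x) := by
      refine slope_le_of_isLocalMax hint hφ hx ?_
      filter_upwards [sawtooth_eventually_left_decreasing hs0 hs1 hpos hle] with y h1
      rw [sawtoothSlope_of_le h1.1, add_zero]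
      exact hP.monotoneOn_upperInverse (by rw [mem_Ici]; linarith [hV y]) ht0 (by linarith)
    rcases hle.eq_or_lt with heq | hlt
    · have ht1 : 0 - sawtooth s x = 1 := by
        rw [sawtooth_eq_left hs1 hle, heq, div_self hs0.ne']; ring
      rw [ht1] at hqle ⊢
      rw [hF.upperInverse_one_eq_lowerInverse_one] at hqle
      exact hP.apply_le_of_le_lowerInverse zero_le_one hq0 hqle
    · have hleq : upperInverse F (0 - sawtooth s x) ≤ q := by
        refine le_slope_of_isLocalMax hint hφ hx ?_
        filter_upwards [sawtooth_eventually_right_decreasing hs0 hs1 hlt] with y h1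
        rw [sawtoothSlope_of_le h1.1, add_zero]
        exact hP.monotoneOn_upperInverse ht0 (by rw [mem_Ici]; linarith [hV y]) (by linarith)
      rw [le_antisymm hqle hleq, hP.apply_upperInverse ht0]

/-- At a level `b` below the local minimum `1/3` of the profile the explicit function is a
supersolution. At `x ∈ ℤ` this uses that both branches agree at level `b`. On the decreasing part
only the slopes to the left of `x` matter: a slope that is at least `upperInverse F t` for every
`t < b - sawtooth s x` satisfies the inequality, so that upward jumps and the constant `A` are
harmless. -/
theorem corrector_sawtoothSlope_super (hF : IsNonconvexProfile F) (hs0 : 0 < s) (hs1 : s < 1)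
    (hb0 : 0 < b) (hb : b < 1 / 3) (hA : 0 ≤ A)
    {φ : ℝ → ℝ} (hφ : ContDiff ℝ 1 φ) {x : ℝ}
    (hx : IsLocalMin (fun y => corrector (sawtoothSlope F s b A) y - φ y) x) :
    b ≤ F |(∫ t in (0 : ℝ)..1, sawtoothSlope F s b A t) + deriv φ x| + sawtooth s x := by
  have hP := hF.isCoerciveProfile
  have hint := intervalIntegrable_sawtoothSlope (A := A) hP hs0 hs1 hb0.le
  set q := (∫ t in (0 : ℝ)..1, sawtoothSlope F s b A t) + deriv φ x with hq
  have hV := sawtooth_nonpos hs0 hs1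
  have hVc := continuous_sawtooth hs0 hs1
  have hq0 : 0 ≤ q := le_slope_of_isLocalMin hint hφ hx
    (Eventually.of_forall (sawtoothSlope_nonneg hP hs0 hs1 hb0.le hA))
  rw [abs_of_nonneg hq0]
  suffices h : b - sawtooth s x ≤ F q by linarith
  have ht0 : 0 < b - sawtooth s x := by linarith [hV x]
  by_cases hinc : Int.fract x = 0 ∨ s < Int.fract x
  · have hleq : lowerInverse F (b - sawtooth s x) ≤ q := by
      refine le_slope_of_isLocalMin hint hφ hx ?_
      filter_upwards [sawtooth_eventually_left_increasing hs0 hs1 hinc] with y h1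
      rw [sawtoothSlope_of_lt h1.1]
      exact hP.monotone_lowerInverse (by linarith)
    rcases hinc with heq | hlt
    · have hb' : b - sawtooth s x = b := by
        rw [sawtooth_eq_left hs1 (by linarith), heq]; simp
      rw [hb', ← hF.upperInverse_eq_lowerInverse_of_lt hb0.le hb] at hleq
      rw [hb']
      exact hP.le_apply_of_upperInverse_le hb0.le hleq
    · have hqle : q ≤ lowerInverse F (b - sawtooth s x) := by
        refine slope_le_of_isLocalMin hint hφ hx ?_
        filter_upwards [sawtooth_eventually_right_increasing hs0 hs1 hlt.le] with y h1
        rw [sawtoothSlope_of_lt h1.1]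
        exact hP.monotone_lowerInverse (by linarith)
      rw [le_antisymm hqle hleq, hP.apply_lowerInverse ht0.le]
  · obtain ⟨hne, hle⟩ := not_or.1 hinc
    have hpos : 0 < Int.fract x := lt_of_le_of_ne (Int.fract_nonneg x) (Ne.symm hne)
    rw [not_lt] at hle
    refine le_of_forall_lt_imp_le_of_dense fun t ht => (le_max_left t 0).trans ?_
    refine hP.le_apply_of_upperInverse_le (le_max_right t 0)
      (le_slope_of_isLocalMin hint hφ hx ?_)
    filter_upwards [sawtooth_eventually_left_decreasing hs0 hs1 hpos hle, nhdsWithin_le_nhds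
      (hVc.continuousAt.eventually_lt_const
        (show sawtooth s x < b - max t 0 by linarith [max_lt ht ht0]))] with y h1 h2
    rw [sawtoothSlope_of_le h1.1]
    refine le_add_of_le_of_nonneg (hP.monotoneOn_upperInverse (le_max_right t 0) ?_ ?_) hA
    · rw [mem_Ici]; linarith [hV y]
    · linarith

end Slope

/-- For a nonconvex profile the effective Hamiltonian determines the shape of the sawtooth: if
`s < L`, then at the mean slope of the explicit subsolution at level `0` for `sawtooth L` there is a
supersolution at a positive level for `sawtooth s`. -/
theorem effectiveHamiltonian_sawtooth_ne {F : ℝ → ℝ} (hF : IsNonconvexProfile F) {s L : ℝ}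
    (hs0 : 0 < s) (hsL : s < L) (hL1 : L < 1) :
    effectiveHamiltonian (fun p => F |p|) (sawtooth L) ≠
      effectiveHamiltonian (fun p => F |p|) (sawtooth s) := by
  intro heq
  have hP := hF.isCoerciveProfile
  have hL0 : 0 < L := hs0.trans hsL
  have hs1 : s < 1 := hsL.trans hL1
  set α := ∫ t in (0 : ℝ)..1, upperInverse F t with hα
  set β := ∫ t in (0 : ℝ)..1, lowerInverse F t with hβ
  have hαβ : β < α := hF.integral_lowerInverse_lt
  set B := upperInverse F 2 with hB
  have hB0 : 0 ≤ B := hP.upperInverse_nonneg zero_le_two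
  obtain ⟨b, hb0, hb4, hbB⟩ : ∃ b > 0, b ≤ 1 / 4 ∧ b * (B + 1) ≤ (L - s) * (α - β) := by
    have h1 : 0 < (L - s) * (α - β) := mul_pos (by linarith) (by linarith)
    refine ⟨min (1 / 4) ((L - s) * (α - β) / (B + 1)), by positivity, min_le_left _ _, ?_⟩
    rw [← le_div_iff₀ (by positivity)]
    exact min_le_right _ _
  -- shifting the interval of integration by `b` changes the integrals by at most `b * B`
  have hshift : ∀ f : ℝ → ℝ,
      (∀ x y, 0 ≤ x → 0 ≤ y → IntervalIntegrable f MeasureTheory.volume x y) →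
      (∀ t, 0 ≤ t → 0 ≤ f t) → (∀ t, 0 ≤ t → t ≤ 2 → f t ≤ B) →
      ∫ t in b..(b + 1), f t ≤ (∫ t in (0 : ℝ)..1, f t) + b * B := by
    intro f hfi hf0 hfB
    have h1 := intervalIntegral.integral_add_adjacent_intervals
      (hfi 0 b le_rfl hb0.le) (hfi b (b + 1) hb0.le (by linarith))
    have h2 := intervalIntegral.integral_add_adjacent_intervals
      (hfi 0 1 le_rfl zero_le_one) (hfi 1 (b + 1) zero_le_one (by linarith))
    have h3 : 0 ≤ ∫ t in (0 : ℝ)..b, f t :=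
      intervalIntegral.integral_nonneg hb0.le fun t ht => hf0 t ht.1
    have h4 : ∫ t in (1 : ℝ)..(b + 1), f t ≤ ∫ _ in (1 : ℝ)..(b + 1), B :=
      intervalIntegral.integral_mono_on (by linarith) (hfi _ _ zero_le_one (by linarith))
        intervalIntegrable_const fun t ht => hfB t (by linarith [ht.1]) (by linarith [ht.2])
    rw [intervalIntegral.integral_const, smul_eq_mul] at h4
    linarith
  have hupB : ∀ t, 0 ≤ t → t ≤ 2 → upperInverse F t ≤ B := fun t ht0 ht2 =>
    hP.monotoneOn_upperInverse ht0 (mem_Ici.2 zero_le_two) ht2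
  have hα' := hshift (upperInverse F) (fun x y hx hy => hP.intervalIntegrable_upperInverse hx hy)
    (fun t ht => hP.upperInverse_nonneg ht) hupB
  have hβ' := hshift (lowerInverse F) (fun x y _ _ => hP.intervalIntegrable_lowerInverse x y)
    (fun t _ => hP.lowerInverse_nonneg t)
    (fun t ht0 ht2 => (hP.lowerInverse_le_upperInverse ht0).trans (hupB t ht0 ht2))
  set p := L * α + (1 - L) * β with hp
  set p' := s * (∫ t in b..(b + 1), upperInverse F t) +
    (1 - s) * ∫ t in b..(b + 1), lowerInverse F t with hp'
  have hp'p : p' ≤ p := by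
    have h1 := mul_le_mul_of_nonneg_left hα' hs0.le
    have h2 := mul_le_mul_of_nonneg_left hβ' (by linarith : 0 ≤ 1 - s)
    have h3 : p' ≤ s * α + (1 - s) * β + b * B := by
      rw [hp']; linarith
    rw [hp]
    linarith
  -- `A` raises the mean slope of the supersolution to that of the subsolution
  set A := (p - p') / s with hA
  have hA0 : 0 ≤ A := div_nonneg (by linarith) hs0.le
  have hmeanL : ∫ t in (0 : ℝ)..1, sawtoothSlope F L 0 0 t = p := by
    rw [integral_sawtoothSlope hP hL0 hL1 le_rfl, zero_add, add_zero]
  have hmeans : ∫ t in (0 : ℝ)..1, sawtoothSlope F s b A t = p := by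
    rw [integral_sawtoothSlope hP hs0 hs1 hb0.le, mul_add, hA, mul_div_cancel₀ _ hs0.ne', hp']
    ring
  have hsub := @corrector_sawtoothSlope_sub F L hF hL0 hL1
  have hsup := @corrector_sawtoothSlope_super F s b A hF hs0 hs1 hb0 (by linarith) hA0
  rw [hmeanL] at hsub
  rw [hmeans] at hsup
  have hintL := intervalIntegrable_sawtoothSlope (A := 0) hP hL0 hL1 le_rfl
  have hints := intervalIntegrable_sawtoothSlope (A := A) hP hs0 hs1 hb0.le
  have hcL := continuous_sawtooth hL0 hL1
  have hcs := continuous_sawtooth hs0 hs1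
  obtain ⟨_, ⟨v, hv⟩, -⟩ := existsUnique_cellSolvable hP.continuous_abs hP.isCoerciveHamiltonian hcL
    (sawtooth_periodic L) p
  obtain ⟨_, ⟨w, hw⟩, -⟩ := existsUnique_cellSolvable hP.continuous_abs hP.isCoerciveHamiltonian hcs
    (sawtooth_periodic s) p
  have e1 := effectiveHamiltonian_eq_of_cellSolvable hP.continuous_abs hP.isCoerciveHamiltonian hcL
    (sawtooth_periodic L) ⟨v, hv⟩
  have e2 := effectiveHamiltonian_eq_of_cellSolvable hP.continuous_abs hP.isCoerciveHamiltonian hcs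
    (sawtooth_periodic s) ⟨w, hw⟩
  have h1 := level_le_of_sub_super (H := fun p => F |p|) hcL (continuous_corrector hintL)
    (periodic_corrector hintL (periodic_sawtoothSlope F L 0 0)) hv.continuous hv.periodic
    (fun φ hφ x hx => hsub hφ hx) hv.supersolution
  have h2 := level_le_of_sub_super (H := fun p => F |p|) hcs hw.continuous hw.periodic
    (continuous_corrector hints) (periodic_corrector hints (periodic_sawtoothSlope F s b A))
    hw.subsolution (fun φ hφ x hx => hsup hφ hx)
  rw [← e1, heq] at h1
  rw [← e2] at h2
  linarith

theorem theorem1p4 (s : ℝ) (hs0 : 0 < s) (hs1 : s < 1)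
    (m : ℕ) (a c : ℕ → ℝ) (V : ℝ → ℝ) (hV : IsOscillatingPL m a c V) :
    -- the effective Hamiltonians are well defined
    (∀ H : ℝ → ℝ, Continuous H → IsCoerciveHamiltonian H → ∀ p : ℝ,
      (∃! b : ℝ, CellSolvable H V p b) ∧ (∃! b : ℝ, CellSolvable H (sawtooth s) p b)) ∧
    -- (1) the balance condition suffices for indistinguishability
    (∑ i ∈ Finset.Ico 1 m, (c i - a i) / s = ∑ i ∈ Finset.Ico 1 m, (a (i + 1) - c i) / (1 - s) →
      MacroscopicallyIndistinguishable V (sawtooth s)) ∧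
    -- (2) for `H(p) = F(|p|)` the balance condition is necessary
    (∀ F : ℝ → ℝ, IsNonconvexProfile F →
      effectiveHamiltonian (fun p => F |p|) V =
        effectiveHamiltonian (fun p => F |p|) (sawtooth s) →
      ∑ i ∈ Finset.Ico 1 m, (c i - a i) / s =
        ∑ i ∈ Finset.Ico 1 m, (a (i + 1) - c i) / (1 - s)) := by
  have hsaw : ∀ L : ℝ, ∑ i ∈ Finset.Ico 1 m, (c i - a i) = L →
      MacroscopicallyIndistinguishable V (sawtooth L) := by
    intro L hL H hH hHc
    have hcL := continuous_sawtooth (hL ▸ hV.length_pos) (hL ▸ hV.length_lt_one)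
    funext p
    obtain ⟨b, hb, -⟩ := existsUnique_cellSolvable hH hHc hcL (sawtooth_periodic L) p
    rw [effectiveHamiltonian_eq_of_cellSolvable hH hHc hcL (sawtooth_periodic L) hb,
      effectiveHamiltonian_eq_of_cellSolvable hH hHc hV.continuous hV.periodic
        (hV.cellSolvable_of_sawtooth hL hb)]
  refine ⟨fun H hH hHc p => ⟨existsUnique_cellSolvable hH hHc hV.continuous hV.periodic p,
    existsUnique_cellSolvable hH hHc (continuous_sawtooth hs0 hs1) (sawtooth_periodic s) p⟩,
    fun hB => hsaw s ((hV.balance_iff hs0 hs1).1 hB), fun F hF heq => ?_⟩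
  rw [hV.balance_iff hs0 hs1]
  have hP := hF.isCoerciveProfile
  rw [hsaw _ rfl _ hP.continuous_abs hP.isCoerciveHamiltonian] at heq
  rcases lt_trichotomy (∑ i ∈ Finset.Ico 1 m, (c i - a i)) s with h | h | h
  · exact absurd heq.symm (effectiveHamiltonian_sawtooth_ne hF hV.length_pos h hs1)
  · exact h
  · exact absurd heq (effectiveHamiltonian_sawtooth_ne hF hs0 h hV.length_lt_one)
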